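/- Let $\lambda=(\lambda_1\ge\lambda_2\ge\cdots)$ be a nonempty self-conjugate integer partition, identified with its Young diagram $\{(i,j): 1\le i\le \ell,\ 1\le j\le\lambda_i\}$, where $\ell=\ell(\lambda)\ge 1$ is its number of nonzero parts; self-conjugate means that $(i,j)\in\lambda$ if and only if $(j,i)\in\lambda$. For $N\ge1$ let $N\lambda$ be the Young diagram obtained from $\lambda$ by replacing every box with an $N\times N$ grid of boxes. A $\lambda$-plane tree is a pair $(T,c)$, where $T$ is a (rooted) plane tree with vertex set $V$ and edge set $E$, and $c\colon V\to\{1,\dots,\ell\}$ is a labelling such that $(c(u),c(v))\in\lambda$ whenever $\{u,v\}\in E$. For $k\ge0$ let $C_k^\lambda$ be the number of $\lambda$-plane trees on $k+1$ vertices. There is a probability distribution $F^\lambda$ on $[0,\infty)$, with compact support and depending only on $\lambda$, whose moments are $$\int_0^\infty x^k\,\mathrm dF^\lambda(x)=\frac{C_k^\lambda}{\ell},\qquad k\ge 0;$$ it is the only probability distribution on $\mathbb R$ with these moments, and the following holds. Let $\{X_{i,j}\colon i,j\ge1\}$ be any collection of i.i.d. complex random variables with $\mathbb E X_{i,j}=0$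 and $\mathbb E|X_{i,j}|^2=1$. For $N\ge1$ let $X_N$ be the $N\ell\times N\ell$ matrix whose $(i,j)$ entry is $X_{i,j}$ if $(i,j)\in N\lambda$ and $0$ otherwise, let $W_N=\frac1N X_NX_N^*$, with eigenvalues $x^{(N)}_1\le\dots\le x^{(N)}_{N\ell}$, and let $$F_N(x)=\frac1{N\ell}\,\#\bigl\{j : x^{(N)}_j\le x\bigr\},\qquad x\in\mathbb R.$$ Then, almost surely, $F_N$ converges in distribution to $F^\lambda$ as $N\to\infty$; that is, almost surely, $F_N(x)\to F^\lambda(x)$ at every continuity point $x$ of the distribution function of $F^\lambda$. -/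

import Mathlib

open MeasureTheory ProbabilityTheory Filter Topology

/-! Partitions are Mathlib's `YoungDiagram`s, i.e. finite lower sets of boxes `(i, j) : ℕ × ℕ`;
rows, columns and vertex labels are therefore numbered from `0` instead of from `1`. -/

namespace YoungDiagram

/-- The length `ℓ(lam)` of a partition: its number of nonzero rows. -/
def length (lam : YoungDiagram) : ℕ := lam.colLen 0

/-- The dilation `N lam`: every box of `lam` is replaced with an `N × N` grid of boxes.
(The bounding rectangle only serves to exhibit finiteness; for `N = 0` the result is empty.) -/
def dilate (N : ℕ) (lam : YoungDiagram) : YoungDiagram where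
  cells := (Finset.range (N * lam.colLen 0) ×ˢ Finset.range (N * lam.rowLen 0)).filter
    fun c => (c.1 / N, c.2 / N) ∈ lam
  isLowerSet := by
    rintro ⟨i, j⟩ ⟨i', j'⟩ hle h
    have h1 : i' ≤ i := hle.1
    have h2 : j' ≤ j := hle.2
    simp only [Finset.coe_filter, Finset.mem_product, Finset.mem_range, Set.mem_ofPred_eq] at h ⊢
    exact ⟨⟨h1.trans_lt h.1.1, h2.trans_lt h.1.2⟩,
      lam.up_left_mem (Nat.div_le_div_right h1) (Nat.div_le_div_right h2) h.2⟩

theorem mem_dilate {N : ℕ} (hN : 0 < N) (lam : YoungDiagram) (i j : ℕ) :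
    (i, j) ∈ lam.dilate N ↔ (i / N, j / N) ∈ lam := by
  rw [← mem_cells]
  simp only [dilate, Finset.mem_filter, Finset.mem_product, Finset.mem_range,
    and_iff_right_iff_imp]
  intro h
  constructor
  · have := mem_iff_lt_colLen.1 (lam.up_left_mem le_rfl (Nat.zero_le _) h)
    rw [mul_comm]
    exact (Nat.div_lt_iff_lt_mul hN).1 this
  · have := mem_iff_lt_rowLen.1 (lam.up_left_mem (Nat.zero_le _) le_rfl h)
    rw [mul_comm]
    exact (Nat.div_lt_iff_lt_mul hN).1 this

end YoungDiagram

/-- Plane trees (rooted, with the children of every vertex linearly ordered) all of whose vertices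
carry a label in `α`: a root label together with the ordered list of the subtrees at the
children of the root. This is the same thing as a pair `(T, c)` of a plane tree `T` with vertex set
`V` and a labelling `c : V → α`. -/
inductive LabelledPlaneTree (α : Type) : Type
  | node (a : α) (children : List (LabelledPlaneTree α)) : LabelledPlaneTree α

namespace LabelledPlaneTree

/-- The label of the root. -/
def rootLabel {α : Type} : LabelledPlaneTree α → α
  | node a _ => a

/-- The number of vertices. -/
def numVertices {α : Type} : LabelledPlaneTree α → ℕ
  | node _ ts => 1 + (ts.map numVertices).sum

/-- The condition `(c(u), c(v)) ∈ lam` for every edge `{u, v}`, in both orders of its endpoints.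
The edges of a tree are those from its root to the roots of its child subtrees, and
the edges of these subtrees. -/
inductive IsLambdaPlane (lam : YoungDiagram) : LabelledPlaneTree (Fin lam.length) → Prop
  | node (a : Fin lam.length) (ts : List (LabelledPlaneTree (Fin lam.length)))
      (hedge : ∀ t ∈ ts, ((a : ℕ), (t.rootLabel : ℕ)) ∈ lam ∧ ((t.rootLabel : ℕ), (a : ℕ)) ∈ lam)
      (hsub : ∀ t ∈ ts, IsLambdaPlane lam t) : IsLambdaPlane lam (.node a ts)

theorem numVertices_node {α : Type} (a : α) (ts : List (LabelledPlaneTree α)) :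
    (node a ts).numVertices = 1 + (ts.map numVertices).sum := by
  rw [numVertices]

theorem numVertices_pos {α : Type} (t : LabelledPlaneTree α) : 0 < t.numVertices := by
  cases t; rw [numVertices_node]; omega

theorem length_le_sum {α : Type} (ts : List (LabelledPlaneTree α)) : ts.length ≤ (ts.map numVertices).sum := by
  induction ts with
  | nil => simp
  | cons t ts ih => have := numVertices_pos t; simp; omega

theorem finite_numVertices_le {α : Type} [Finite α] (n : ℕ) : {t : LabelledPlaneTree α | t.numVertices ≤ n}.Finite := by
  induction n with
  | zero => 
    convert Set.finite_empty
    ext t; have := numVertices_pos t; simp; omega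
  | succ n ih =>
    set S := {t : LabelledPlaneTree α | t.numVertices ≤ n}
    have : Finite S := ih
    refine (((Set.finite_univ (α := α)).prod (List.finite_length_le S n)).image
      (fun p => node p.1 (p.2.map Subtype.val))).subset ?_
    rintro ⟨a, ts⟩ h
    change (node a ts).numVertices ≤ n + 1 at h
    rw [numVertices_node] at h
    have hl := length_le_sum ts
    have hm : ∀ t ∈ ts, t ∈ S := fun t ht => by
      have := List.single_le_sum (l := ts.map numVertices) (by simp) t.numVertices (List.mem_map_of_mem ht)
      change t.numVertices ≤ n
      omega
    refine ⟨(a, ts.attach.map fun t => ⟨t.1, hm t.1 t.2⟩), ⟨trivial, ?_⟩, ?_⟩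
    · simp; omega
    · simp [Function.comp_def]

end LabelledPlaneTree

/-- The set of `lam`-plane trees on `n` vertices. -/
def lambdaPlaneTrees (lam : YoungDiagram) (n : ℕ) : Set (LabelledPlaneTree (Fin lam.length)) :=
  {t | t.numVertices = n ∧ t.IsLambdaPlane lam}

/-- There are finitely many of them, so that the cardinality below is a genuine one. -/
theorem lambdaPlaneTrees_finite (lam : YoungDiagram) (n : ℕ) : (lambdaPlaneTrees lam n).Finite :=
  (LabelledPlaneTree.finite_numVertices_le n).subset fun _ h => h.1.le

/-- `C_k`: the number of `lam`-plane trees on `k + 1` vertices. -/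
noncomputable def lambdaCatalan (lam : YoungDiagram) (k : ℕ) : ℕ :=
  (lambdaPlaneTrees lam (k + 1)).ncard

/-- The matrix `X_N` of size `Nℓ × Nℓ`, equal to `x i j` at the boxes `(i, j)` of `N lam` and zero
elsewhere. -/
def shapedMatrix (lam : YoungDiagram) (x : ℕ → ℕ → ℂ) (N : ℕ) :
    Matrix (Fin (N * lam.length)) (Fin (N * lam.length)) ℂ :=
  Matrix.of fun i j => if ((i : ℕ), (j : ℕ)) ∈ lam.dilate N then x i j else 0

/-- `W_N = (1 / N) X_N X_N^*`. -/
noncomputable def covMatrix (lam : YoungDiagram) (x : ℕ → ℕ → ℂ) (N : ℕ) :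
    Matrix (Fin (N * lam.length)) (Fin (N * lam.length)) ℂ :=
  ((N : ℝ)⁻¹) • (shapedMatrix lam x N * (shapedMatrix lam x N).conjTranspose)

theorem covMatrix_isHermitian (lam : YoungDiagram) (x : ℕ → ℕ → ℂ) (N : ℕ) :
    (covMatrix lam x N).IsHermitian := by
  have h := Matrix.isHermitian_mul_conjTranspose_self (shapedMatrix lam x N)
  unfold Matrix.IsHermitian at h ⊢
  rw [covMatrix, Matrix.conjTranspose_smul, h, star_trivial]

/-- The empirical distribution function `F_N` of the `Nℓ` eigenvalues (with multiplicity)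
of `W_N`. -/
noncomputable def empiricalCDF (lam : YoungDiagram) (x : ℕ → ℕ → ℂ) (N : ℕ) (s : ℝ) : ℝ :=
  (Nat.card {j : Fin (N * lam.length) // (covMatrix_isHermitian lam x N).eigenvalues j ≤ s} : ℝ)
    / (N * lam.length : ℝ)

/-- `F` has finite moments of all orders, and its `k`-th moment is `C_k / ℓ` for all `k ≥ 0`. -/
def HasLambdaMoments (lam : YoungDiagram) (F : ProbabilityMeasure ℝ) : Prop :=
  ∀ k : ℕ, Integrable (fun s : ℝ => s ^ k) (F : Measure ℝ) ∧
    ∫ s, s ^ k ∂(F : Measure ℝ) = (lambdaCatalan lam k : ℝ) / (lam.length : ℝ)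

/-! The proof is the resolvent method at real spectral parameters `-t`, `t > 0`. Let `A` be the
scaled matrix. The Schur complement formula (`colResolvent_conjTranspose_diag`) writes the `i`-th
diagonal entry of `(A Aᴴ + t)⁻¹` as `1 / (t (1 + q))`, where `q` is a quadratic form in the `i`-th
row whose coefficients come from the column resolvent of the remaining rows. That row is independent
of the coefficients, so `q` is close to the sum of the normalized partial traces over the column
blocks `b` with `(a, b) ∈ lam`, where `a` is the block of `i`; the truncation behind
`integral_abs_quadForm_sub_trace_le` makes second moments suffice. Changing one row moves a block
trace by at most `1 / (t N)`, so McDiarmid's inequality over the rows concentrates the block traces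
around their means, with tails small enough for almost sure statements.

Let `e` and `e'` be the expected block traces for the array and for its conjugate transpose. As
`lam` is self-conjugate, both arrays have the same shape, and `e' a ≈ 1 / (t (1 + ∑ e b))`, summed
over `b` with `(a, b) ∈ lam`, together with the same relation with `e` and `e'` exchanged. Trees
solve this system exactly: cutting off the leftmost subtree at the root gives a quadratic recursion
for the number of trees with root label `a`, which becomes the fixed point equation of
`treeTransform` (`treeTransform_eq`). For `t ≥ 8ℓ` the system is a contraction, so the block traces
converge to `treeTransform`.

The average of the block traces is the Stieltjes transform of the spectral distribution. It
therefore converges, at all large integers `t`, to a series in `-1 / t` with coefficients `C_k / ℓ ≤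
(4ℓ) ^ k`. Its behaviour as `t → ∞` gives tightness, its expansion in `1 / t` gives the moments of
every cluster point, and these moments determine a compactly supported measure
(`exists_tendsto_of_stieltjes`). The measure `F` itself is obtained from one sample of an array of
random signs. -/

/-! ### Resolvents at negative parameters and rank-one row perturbations -/

namespace Matrix

variable {m n : Type*} [Fintype m] [Fintype n] [DecidableEq n]

/-- The resolvent `(Aᴴ A + t)⁻¹`. -/
noncomputable def colResolvent (t : ℝ) (A : Matrix m n ℂ) : Matrix n n ℂ :=
  (Aᴴ * A + (t : ℂ) • (1 : Matrix n n ℂ))⁻¹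

variable {t : ℝ}

open scoped ComplexOrder in
theorem isUnit_det_conjTranspose_mul_self_add (ht : 0 < t) (A : Matrix m n ℂ) :
    IsUnit (Aᴴ * A + (t : ℂ) • (1 : Matrix n n ℂ)).det := by
  have h1 : ((t : ℂ) • (1 : Matrix n n ℂ)).PosDef := by
    exact PosDef.smul PosDef.one (by exact_mod_cast ht)
  have h := PosDef.posSemidef_add (posSemidef_conjTranspose_mul_self A) h1
  exact h.isUnit.map Matrix.detMonoidHom

theorem mul_colResolvent (ht : 0 < t) (A : Matrix m n ℂ) :
    (Aᴴ * A + (t : ℂ) • (1 : Matrix n n ℂ)) * colResolvent t A = 1 :=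
  mul_nonsing_inv _ (isUnit_det_conjTranspose_mul_self_add ht A)

theorem colResolvent_isHermitian (t : ℝ) (A : Matrix m n ℂ) : (colResolvent t A).IsHermitian := by
  apply IsHermitian.inv
  apply IsHermitian.add (isHermitian_conjTranspose_mul_self A)
  simp [IsHermitian, conjTranspose_smul]

theorem colResolvent_conj (t : ℝ) (A : Matrix m n ℂ) (j k : n) :
    star (colResolvent t A j k) = colResolvent t A k j :=
  (colResolvent_isHermitian t A).apply k j

omit [DecidableEq n] in
theorem star_dotProduct_self_eq (v : n → ℂ) : star v ⬝ᵥ v = ((∑ j, ‖v j‖ ^ 2 : ℝ) : ℂ) := by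
  simp [dotProduct, Complex.conj_mul']

/-- With `u` the resolvent applied to `v`, one has `v = (Aᴴ A + t) u`, and the form becomes `‖A u‖²
+ t ‖u‖²`. This yields at once that the form is real and nonnegative, and the bound on `‖u‖²` from
which all later estimates follow. -/
theorem star_dotProduct_colResolvent (ht : 0 < t) (A : Matrix m n ℂ) (v : n → ℂ) :
    star v ⬝ᵥ (colResolvent t A *ᵥ v) =
      ((∑ i, ‖(A *ᵥ (colResolvent t A *ᵥ v)) i‖ ^ 2 +
        t * ∑ j, ‖(colResolvent t A *ᵥ v) j‖ ^ 2 : ℝ) : ℂ) := by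
  set u := colResolvent t A *ᵥ v with hu
  have hv : v = Aᴴ *ᵥ (A *ᵥ u) + (t : ℂ) • u := by
    have : (Aᴴ * A + (t : ℂ) • (1 : Matrix n n ℂ)) *ᵥ u = v := by
      rw [hu, mulVec_mulVec, mul_colResolvent ht, one_mulVec]
    conv_lhs => rw [← this]
    rw [add_mulVec, smul_mulVec, one_mulVec, ← mulVec_mulVec]
  have h1 : star v ⬝ᵥ u = star (A *ᵥ u) ⬝ᵥ (A *ᵥ u) + (t : ℂ) * (star u ⬝ᵥ u) := by
    conv_lhs => rw [hv]
    rw [star_add, add_dotProduct, star_mulVec, conjTranspose_conjTranspose, ← dotProduct_mulVec,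
      star_smul, smul_dotProduct]
    simp
  rw [h1, star_dotProduct_self_eq, star_dotProduct_self_eq]
  push_cast
  ring

/-- The quadratic form of the resolvent. -/
noncomputable def resolventForm (t : ℝ) (A : Matrix m n ℂ) (v : n → ℂ) : ℝ :=
  (star v ⬝ᵥ (colResolvent t A *ᵥ v)).re

theorem coe_resolventForm (ht : 0 < t) (A : Matrix m n ℂ) (v : n → ℂ) :
    (resolventForm t A v : ℂ) = star v ⬝ᵥ (colResolvent t A *ᵥ v) := by
  rw [resolventForm, star_dotProduct_colResolvent ht, Complex.ofReal_re]

theorem mul_sum_norm_sq_le_resolventForm (ht : 0 < t) (A : Matrix m n ℂ) (v : n → ℂ) :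
    t * ∑ j, ‖(colResolvent t A *ᵥ v) j‖ ^ 2 ≤ resolventForm t A v := by
  rw [resolventForm, star_dotProduct_colResolvent ht, Complex.ofReal_re]
  have : 0 ≤ ∑ i, ‖(A *ᵥ (colResolvent t A *ᵥ v)) i‖ ^ 2 := by positivity
  linarith

theorem resolventForm_nonneg (ht : 0 < t) (A : Matrix m n ℂ) (v : n → ℂ) :
    0 ≤ resolventForm t A v :=
  le_trans (by positivity) (mul_sum_norm_sq_le_resolventForm ht A v)

theorem resolventForm_single (A : Matrix m n ℂ) (j : n) :
    resolventForm t A (Pi.single j 1) = (colResolvent t A j j).re := by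
  rw [resolventForm, mulVec_single_one, ← Pi.single_star, star_one, single_one_dotProduct]
  rfl

theorem mul_sum_norm_sq_colResolvent_le (ht : 0 < t) (A : Matrix m n ℂ) (j : n) :
    t * ∑ k, ‖colResolvent t A k j‖ ^ 2 ≤ (colResolvent t A j j).re := by
  have := mul_sum_norm_sq_le_resolventForm ht A (Pi.single j 1)
  rwa [resolventForm_single, mulVec_single_one] at this

theorem colResolvent_diag_re_nonneg (ht : 0 < t) (A : Matrix m n ℂ) (j : n) :
    0 ≤ (colResolvent t A j j).re :=
  le_trans (by positivity) (mul_sum_norm_sq_colResolvent_le ht A j)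

/-- The diagonal entry `r` is one of the entries of its column, so the column bound gives `t r² ≤
r`. -/
theorem colResolvent_diag_re_le (ht : 0 < t) (A : Matrix m n ℂ) (j : n) :
    (colResolvent t A j j).re ≤ 1 / t := by
  have h1 := mul_sum_norm_sq_colResolvent_le ht A j
  have h2 : ‖colResolvent t A j j‖ ^ 2 ≤ ∑ k, ‖colResolvent t A k j‖ ^ 2 :=
    Finset.single_le_sum (f := fun k => ‖colResolvent t A k j‖ ^ 2) (fun _ _ => by positivity)
      (Finset.mem_univ j)
  have h3 : (colResolvent t A j j).re ^ 2 ≤ ‖colResolvent t A j j‖ ^ 2 := by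
    rw [← sq_abs]
    gcongr
    exact Complex.abs_re_le_norm _
  have h0 := colResolvent_diag_re_nonneg ht A j
  set r := (colResolvent t A j j).re
  rw [le_div_iff₀ ht]
  by_contra! h
  have : t * r ^ 2 ≤ r := (mul_le_mul_of_nonneg_left (h3.trans h2) ht.le).trans h1
  nlinarith

theorem sum_norm_sq_colResolvent_le (ht : 0 < t) (A : Matrix m n ℂ) (j : n) :
    ∑ k, ‖colResolvent t A k j‖ ^ 2 ≤ 1 / t ^ 2 := by
  have h1 := mul_sum_norm_sq_colResolvent_le ht A j
  have h2 := colResolvent_diag_re_le ht A j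
  rw [le_div_iff₀ (by positivity)]
  have := h1.trans h2
  rw [le_div_iff₀ ht] at this
  linarith

variable [DecidableEq m]

omit [Fintype n] [DecidableEq n] in
theorem conjTranspose_mul_self_eq_updateRow (A : Matrix m n ℂ) (i : m) :
    Aᴴ * A = (A.updateRow i 0)ᴴ * A.updateRow i 0 + vecMulVec (star (A i)) (A i) := by
  ext j k
  simp only [mul_apply, add_apply, conjTranspose_apply, vecMulVec_apply, Pi.star_apply]
  rw [← Finset.add_sum_erase _ _ (Finset.mem_univ i),
    ← Finset.add_sum_erase Finset.univ
      (fun l => star (A.updateRow i 0 l j) * A.updateRow i 0 l k) (Finset.mem_univ i)]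
  have : ∀ l ∈ Finset.univ.erase i, star (A.updateRow i 0 l j) * A.updateRow i 0 l k =
      star (A l j) * A l k := by
    intro l hl
    rw [updateRow_ne (Finset.ne_of_mem_erase hl)]
  rw [Finset.sum_congr rfl this]
  simp [add_comm]

/-- This is the Sherman–Morrison formula: row `i` contributes a rank-one summand to `Aᴴ A`.
Positivity of the form keeps the denominator `1 + q` away from zero. -/
theorem colResolvent_eq_updateRow (ht : 0 < t) (A : Matrix m n ℂ) (i : m) :
    colResolvent t A = colResolvent t (A.updateRow i 0) -
      (1 + resolventForm t (A.updateRow i 0) (star (A i)) : ℂ)⁻¹ •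
        vecMulVec (colResolvent t (A.updateRow i 0) *ᵥ star (A i))
          (star (colResolvent t (A.updateRow i 0) *ᵥ star (A i))) := by
  set H := colResolvent t (A.updateRow i 0) with hH
  set v := star (A i) with hv
  set q := resolventForm t (A.updateRow i 0) v with hq
  have hq0 : 0 ≤ q := resolventForm_nonneg ht _ _
  have hqc : (1 + q : ℂ) ≠ 0 := by
    norm_cast; positivity
  have hqe : (q : ℂ) = star v ⬝ᵥ (H *ᵥ v) := coe_resolventForm ht _ _
  have hAi : A i = star v := by simp [hv]
  have hHH : Hᴴ = H := colResolvent_isHermitian t _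
  have h1 := mul_colResolvent ht (A.updateRow i 0)
  rw [← hH] at h1
  set M := (A.updateRow i 0)ᴴ * A.updateRow i 0 + (t : ℂ) • (1 : Matrix n n ℂ) with hM
  rw [colResolvent]
  apply inv_eq_right_inv
  have h2 : Aᴴ * A + (t : ℂ) • (1 : Matrix n n ℂ) = M + vecMulVec v (star v) := by
    rw [conjTranspose_mul_self_eq_updateRow A i, hM, ← hAi]; abel
  have h3 : star (H *ᵥ v) = star v ᵥ* H := by rw [star_mulVec, hHH]
  rw [h2, h3, add_mul, mul_sub, mul_sub, h1, mul_smul_comm, mul_smul_comm, vecMulVec_mul_vecMulVec,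
    mul_vecMulVec, mulVec_mulVec, h1, one_mulVec, ← hqe, vecMulVec_mul, vecMulVec_smul,
    smul_smul]
  have : vecMulVec v (star v ᵥ* H) = ((1 + q : ℂ)⁻¹ + (1 + q : ℂ)⁻¹ * q) • vecMulVec v (star v ᵥ* H) := by
    rw [show (1 + q : ℂ)⁻¹ + (1 + q : ℂ)⁻¹ * q = 1 by field_simp, one_smul]
  nth_rewrite 2 [this]
  rw [add_smul]
  abel

/-- Zeroing a row changes a partial trace of the resolvent by at most `1 / t`. -/
theorem colResolvent_updateRow_sum_sub (ht : 0 < t) (A : Matrix m n ℂ) (i : m) (B : Finset n) :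
    ∑ j ∈ B, (colResolvent t A j j).re ≤ ∑ j ∈ B, (colResolvent t (A.updateRow i 0) j j).re ∧
    ∑ j ∈ B, (colResolvent t (A.updateRow i 0) j j).re ≤
      ∑ j ∈ B, (colResolvent t A j j).re + 1 / t := by
  set H := colResolvent t (A.updateRow i 0) with hH
  set v := star (A i) with hv
  set q := resolventForm t (A.updateRow i 0) v with hq
  have hq0 : 0 ≤ q := resolventForm_nonneg ht _ _
  have key : ∀ j, (colResolvent t A j j).re = (H j j).re - (1 + q)⁻¹ * ‖(H *ᵥ v) j‖ ^ 2 := by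
    intro j
    rw [colResolvent_eq_updateRow ht A i, sub_apply, smul_apply, vecMulVec_apply, Pi.star_apply,
      ← hv, ← hq, ← hH, Complex.sub_re]
    congr 1
    rw [Complex.star_def, Complex.mul_conj', smul_eq_mul]
    norm_cast
  have hs : ∑ j ∈ B, (colResolvent t A j j).re = ∑ j ∈ B, (H j j).re -
      (1 + q)⁻¹ * ∑ j ∈ B, ‖(H *ᵥ v) j‖ ^ 2 := by
    rw [Finset.sum_congr rfl fun j _ => key j, Finset.sum_sub_distrib, Finset.mul_sum]
  have h1 : t * ∑ j, ‖(H *ᵥ v) j‖ ^ 2 ≤ q := mul_sum_norm_sq_le_resolventForm ht _ _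
  have h2 : ∑ j ∈ B, ‖(H *ᵥ v) j‖ ^ 2 ≤ ∑ j, ‖(H *ᵥ v) j‖ ^ 2 :=
    Finset.sum_le_sum_of_subset_of_nonneg (Finset.subset_univ _) fun _ _ _ => by positivity
  have h3 : 0 ≤ (1 + q)⁻¹ * ∑ j ∈ B, ‖(H *ᵥ v) j‖ ^ 2 := by positivity
  -- The total mass of the rank-one correction is at most `(q / t) / (1 + q)`, whatever the size of
  -- the row.
  have h4 : (1 + q)⁻¹ * ∑ j ∈ B, ‖(H *ᵥ v) j‖ ^ 2 ≤ 1 / t := by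
    rw [inv_mul_eq_div, div_le_div_iff₀ (by positivity) ht]
    nlinarith
  constructor <;> linarith

/-- Both matrices agree once row `i` is zeroed, so both partial traces lie in the same interval of
length `1 / t`. -/
theorem colResolvent_updateRow_sum_abs_le (ht : 0 < t) (A : Matrix m n ℂ) (i : m) (r r' : n → ℂ)
    (B : Finset n) :
    |∑ j ∈ B, (colResolvent t (A.updateRow i r) j j).re -
      ∑ j ∈ B, (colResolvent t (A.updateRow i r') j j).re| ≤ 1 / t := by
  have h1 := colResolvent_updateRow_sum_sub ht (A.updateRow i r) i B
  have h2 := colResolvent_updateRow_sum_sub ht (A.updateRow i r') i B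
  rw [updateRow_idem] at h1 h2
  rw [abs_le]
  constructor <;> linarith

/-- The diagonal of the row resolvent, in terms of the column resolvent with one row zeroed. -/
theorem colResolvent_conjTranspose_diag (ht : 0 < t) (A : Matrix m n ℂ) (i : m) :
    (colResolvent t Aᴴ i i).re =
      1 / (t * (1 + resolventForm t (A.updateRow i 0) (star (A i)))) := by
  set H := colResolvent t (A.updateRow i 0) with hH
  set v := star (A i) with hv
  set q := resolventForm t (A.updateRow i 0) v with hq
  have hq0 : 0 ≤ q := resolventForm_nonneg ht _ _
  have hqc : (1 + q : ℂ) ≠ 0 := by norm_cast; positivity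
  have htc : (t : ℂ) ≠ 0 := by norm_cast; positivity
  have hqe : (q : ℂ) = star v ⬝ᵥ (H *ᵥ v) := coe_resolventForm ht _ _
  have hAi : A i = star v := by simp [hv]
  have hHH : Hᴴ = H := colResolvent_isHermitian t _
  -- The push-through identity expresses the row resolvent by the column resolvent; Sherman–Morrison
  -- then evaluates the remaining form as `q - q² / (1 + q)`.
  have h1 : colResolvent t Aᴴ = (t : ℂ)⁻¹ • (1 - A * colResolvent t A * Aᴴ) := by
    apply inv_eq_right_inv
    rw [conjTranspose_conjTranspose, mul_smul_comm]
    have h2 : (A * Aᴴ + (t : ℂ) • (1 : Matrix m m ℂ)) * (A * colResolvent t A * Aᴴ) = A * Aᴴ := by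
      calc _ = A * ((Aᴴ * A + (t : ℂ) • (1 : Matrix n n ℂ)) * colResolvent t A) * Aᴴ := by
            simp only [Matrix.add_mul, Matrix.mul_add, Matrix.mul_assoc, Matrix.smul_mul,
              Matrix.one_mul, Matrix.mul_smul]
        _ = _ := by rw [mul_colResolvent ht, Matrix.mul_one]
    rw [mul_sub, h2, mul_one, add_sub_cancel_left, smul_smul, inv_mul_cancel₀ htc, one_smul]
  have h3 : (A * colResolvent t A * Aᴴ) i i = star v ⬝ᵥ (colResolvent t A *ᵥ v) := by
    simp only [mul_apply, dotProduct, mulVec, v, conjTranspose_apply, Pi.star_apply, star_star,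
      Finset.sum_mul, Finset.mul_sum, mul_assoc]
    exact Finset.sum_comm
  have h4 : star v ⬝ᵥ (colResolvent t A *ᵥ v) = q - (1 + q : ℂ)⁻¹ * (q * q) := by
    rw [colResolvent_eq_updateRow ht A i, sub_mulVec, smul_mulVec, dotProduct_sub, ← hv, ← hq,
      ← hH, ← hqe, dotProduct_smul, vecMulVec_mulVec, star_mulVec, hHH, ← dotProduct_mulVec,
      ← hqe, dotProduct_smul, ← hqe]
    simp
  have h5 : colResolvent t Aᴴ i i = ((1 / (t * (1 + q)) : ℝ) : ℂ) := by
    rw [h1, smul_apply, sub_apply, one_apply_eq, h3, h4, smul_eq_mul]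
    push_cast
    field_simp
    ring
  rw [h5, Complex.ofReal_re]

end Matrix

/-! ### The bounded differences inequality -/

section BoundedDifferences

variable {α : Type*} [MeasurableSpace α]

theorem integrable_of_measurable_of_abs_le {Ω : Type*} [MeasurableSpace Ω] {μ : Measure Ω}
    [IsFiniteMeasure μ] {f : Ω → ℝ} (hf : Measurable f) {C : ℝ} (hC : ∀ x, |f x| ≤ C) :
    Integrable f μ :=
  Integrable.of_bound hf.aestronglyMeasurable C (.of_forall hC)

theorem abs_integral_le_of_abs_le {Ω : Type*} [MeasurableSpace Ω] {μ : Measure Ω}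
    [IsProbabilityMeasure μ] {f : Ω → ℝ} {C : ℝ} (hC : ∀ x, |f x| ≤ C) :
    |∫ x, f x ∂μ| ≤ C := by
  simpa using norm_integral_le_of_norm_le_const (μ := μ) (f := f) (.of_forall hC)

/-- Hoeffding's lemma on the interval of radius `c` around one value of `f`. The interval is twice
as long as the oscillation, which only costs a constant. -/
theorem integral_exp_mul_sub_le (ν : Measure α) [IsProbabilityMeasure ν] {f : α → ℝ}
    (hf : Measurable f) {c : ℝ} (hc : 0 ≤ c) (hd : ∀ y y', |f y - f y'| ≤ c) (s : ℝ) :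
    ∫ y, Real.exp (s * (f y - ∫ y, f y ∂ν)) ∂ν ≤ Real.exp (c ^ 2 * s ^ 2 / 2) := by
  obtain ⟨y₀⟩ := nonempty_of_isProbabilityMeasure ν
  have h := (hasSubgaussianMGF_of_mem_Icc (μ := ν) (a := f y₀ - c) (b := f y₀ + c)
    hf.aemeasurable (.of_forall fun y => by
      have := abs_le.1 (hd y y₀)
      constructor <;> linarith)).mgf_le s
  refine h.trans_eq ?_
  congr 3
  rw [show f y₀ + c - (f y₀ - c) = 2 * c by ring]
  simp [abs_of_nonneg hc]

/-- The bounded differences inequality, in exponential form. -/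
theorem integral_exp_pi_le_of_bounded_differences (ν : Measure α) [IsProbabilityMeasure ν] {n : ℕ}
    {f : (Fin n → α) → ℝ} (hf : Measurable f) {C : ℝ} (hC : ∀ x, |f x| ≤ C) {c : ℝ} (hc : 0 ≤ c)
    (hd : ∀ x i y y', |f (Function.update x i y) - f (Function.update x i y')| ≤ c) (s : ℝ) :
    ∫ x, Real.exp (s * (f x - ∫ x, f x ∂Measure.pi fun _ => ν)) ∂(Measure.pi fun _ => ν) ≤
      Real.exp (n * c ^ 2 * s ^ 2 / 2) := by
  induction n with
  | zero =>
    have : ∀ x, f x = f Fin.elim0 := fun x => by rw [Subsingleton.elim x Fin.elim0]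
    simp [this]
  | succ n ih =>
    have hmp := measurePreserving_piFinSuccAbove (fun _ : Fin (n + 1) => ν) 0
    set e := MeasurableEquiv.piFinSuccAbove (fun _ : Fin (n + 1) => α) 0 with he
    set π := Measure.pi fun _ : Fin n => ν
    let F : α × (Fin n → α) → ℝ := fun p => f (e.symm p)
    have hFm : Measurable F := hf.comp e.symm.measurable
    have hFC : ∀ p, |F p| ≤ C := fun p => hC _
    have hF : ∀ p, F p = f (Fin.cons p.1 p.2) := fun p => by
      simp only [F, he, MeasurableEquiv.piFinSuccAbove_symm_apply, Fin.insertNthEquiv_zero]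
      rfl
    have htr : ∀ G : (Fin (n + 1) → α) → ℝ, ∫ x, G x ∂(Measure.pi fun _ => ν) =
        ∫ p, G (e.symm p) ∂(ν.prod π) := fun G => by
      rw [← hmp.symm.integral_comp' (g := G)]
    -- Averaging out the first coordinate preserves bounded differences, so the induction hypothesis
    -- handles `g`. For fixed remaining coordinates, Hoeffding's lemma handles `F - g`, and the two
    -- exponential bounds multiply.
    let g : (Fin n → α) → ℝ := fun y => ∫ a, F (a, y) ∂ν
    have hgm : Measurable g :=
      (StronglyMeasurable.integral_prod_left' hFm.stronglyMeasurable).measurable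
    have hgC : ∀ y, |g y| ≤ C := fun y => abs_integral_le_of_abs_le fun a => hFC _
    have hFi : Integrable F (ν.prod π) := integrable_of_measurable_of_abs_le hFm hFC
    have hgE : ∫ x, f x ∂(Measure.pi fun _ => ν) = ∫ y, g y ∂π := by
      rw [htr, integral_prod_symm _ hFi]
    have hsec : ∀ y, Integrable (fun a => F (a, y)) ν := fun y =>
      integrable_of_measurable_of_abs_le (hFm.comp (measurable_id.prodMk measurable_const))
        fun a => hFC _
    have hgd : ∀ x i y y', |g (Function.update x i y) - g (Function.update x i y')| ≤ c := by
      intro x i y y'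
      simp only [g]
      rw [← integral_sub (hsec _) (hsec _)]
      refine abs_integral_le_of_abs_le fun a => ?_
      rw [hF, hF]
      simp only [Fin.cons_update]
      exact hd _ _ _ _
    have hmain := ih hgm hgC hgd
    rw [hgE, htr]
    set E := ∫ y, g y ∂π with hE
    have hEC : |E| ≤ C := abs_integral_le_of_abs_le hgC
    have hexpC : ∀ u v : ℝ, |u| ≤ C → |v| ≤ C →
        |Real.exp (s * (u - v))| ≤ Real.exp (|s| * (C + C)) := by
      intro u v hu hv
      rw [abs_of_pos (Real.exp_pos _)]
      apply Real.exp_le_exp.2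
      calc s * (u - v) ≤ |s * (u - v)| := le_abs_self _
        _ = |s| * |u - v| := abs_mul _ _
        _ ≤ |s| * (C + C) := by
          gcongr
          exact (abs_sub _ _).trans (by linarith)
    have hint : Integrable (fun p => Real.exp (s * (F p - E))) (ν.prod π) :=
      integrable_of_measurable_of_abs_le (by fun_prop) fun p => hexpC _ _ (hFC _) hEC
    change ∫ p, Real.exp (s * (F p - E)) ∂(ν.prod π) ≤ _
    rw [integral_prod_symm _ hint]
    have hinner : ∀ y, ∫ a, Real.exp (s * (F (a, y) - E)) ∂ν ≤
        Real.exp (c ^ 2 * s ^ 2 / 2) * Real.exp (s * (g y - E)) := by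
      intro y
      have h1 : ∀ a, Real.exp (s * (F (a, y) - E)) =
          Real.exp (s * (F (a, y) - g y)) * Real.exp (s * (g y - E)) := fun a => by
        rw [← Real.exp_add]; ring_nf
      simp only [h1]
      rw [integral_mul_const]
      gcongr
      refine integral_exp_mul_sub_le ν (hFm.comp (measurable_id.prodMk measurable_const)) hc ?_ s
      intro a a'
      simp only [Function.comp_apply, id, hF]
      have := hd (Fin.cons a y) 0 a a'
      simpa only [Fin.update_cons_zero] using this
    calc _ ≤ ∫ y, Real.exp (c ^ 2 * s ^ 2 / 2) * Real.exp (s * (g y - E)) ∂π := by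
          refine integral_mono hint.integral_prod_right ?_ hinner
          refine Integrable.const_mul ?_ _
          exact integrable_of_measurable_of_abs_le (by fun_prop) fun y => hexpC _ _ (hgC _) hEC
      _ ≤ Real.exp (c ^ 2 * s ^ 2 / 2) * Real.exp (n * c ^ 2 * s ^ 2 / 2) := by
          rw [integral_const_mul]
          gcongr
      _ = _ := by
          rw [← Real.exp_add]
          push_cast
          ring_nf

/-- **McDiarmid's inequality**: a function with bounded differences is sub-Gaussian. -/
theorem hasSubgaussianMGF_pi_of_bounded_differences (ν : Measure α) [IsProbabilityMeasure ν] {n : ℕ}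
    {f : (Fin n → α) → ℝ} (hf : Measurable f) {C : ℝ} (hC : ∀ x, |f x| ≤ C) {c : ℝ} (hc : 0 ≤ c)
    (hd : ∀ x i y y', |f (Function.update x i y) - f (Function.update x i y')| ≤ c) :
    HasSubgaussianMGF (fun x => f x - ∫ x, f x ∂Measure.pi fun _ => ν) (n * c.toNNReal ^ 2)
      (Measure.pi fun _ => ν) where
  integrable_exp_mul s := by
    refine integrable_of_measurable_of_abs_le (C := Real.exp (|s| * (C + C))) (by fun_prop)
      fun x => ?_
    rw [abs_of_pos (Real.exp_pos _)]
    apply Real.exp_le_exp.2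
    refine (le_abs_self _).trans ?_
    rw [abs_mul]
    gcongr
    exact (abs_sub _ _).trans (add_le_add (hC x) (abs_integral_le_of_abs_le hC))
  mgf_le s := by
    simpa [mgf, hc] using integral_exp_pi_le_of_bounded_differences ν hf hC hc hd s

end BoundedDifferences

/-! ### First absolute moments and resampling of one coordinate -/

/-- Rests on `|x| ≤ exp x + exp (-x)` at the scale `σ`, where both exponential moments are at most
`exp (1 / 2)`. -/
theorem ProbabilityTheory.HasSubgaussianMGF.integral_abs_le {Ω : Type*} [MeasurableSpace Ω]
    {μ : Measure Ω} {Y : Ω → ℝ} {c : NNReal} (h : HasSubgaussianMGF Y c μ) {σ : ℝ} (hσ : 0 < σ)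
    (hc : (c : ℝ) ≤ σ ^ 2) : ∫ ω, |Y ω| ∂μ ≤ 2 * Real.exp (1 / 2) * σ := by
  have h1 : ∀ s : ℝ, s ^ 2 = (σ⁻¹) ^ 2 → ∫ ω, Real.exp (s * Y ω) ∂μ ≤ Real.exp (1 / 2) := by
    intro s hs
    refine (h.mgf_le s).trans (Real.exp_le_exp.2 ?_)
    rw [hs, div_le_div_iff_of_pos_right two_pos, inv_pow, mul_inv_le_iff₀ (by positivity)]
    linarith
  have h2 : ∀ ω, |Y ω| ≤ σ * (Real.exp (σ⁻¹ * Y ω) + Real.exp (-σ⁻¹ * Y ω)) := by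
    intro ω
    have hx : |Y ω| = σ * |σ⁻¹ * Y ω| := by
      rw [abs_mul, abs_of_pos (inv_pos.2 hσ), mul_inv_cancel_left₀ hσ.ne']
    rw [hx]
    gcongr
    rw [neg_mul]
    set x := σ⁻¹ * Y ω
    have := Real.add_one_le_exp x
    have := Real.add_one_le_exp (-x)
    have := Real.exp_pos x
    have := Real.exp_pos (-x)
    rw [abs_le]
    constructor <;> linarith
  have hi := h.integrable
  calc ∫ ω, |Y ω| ∂μ ≤ ∫ ω, σ * (Real.exp (σ⁻¹ * Y ω) + Real.exp (-σ⁻¹ * Y ω)) ∂μ :=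
        integral_mono hi.abs (((h.integrable_exp_mul _).add (h.integrable_exp_mul _)).const_mul _) h2
    _ ≤ σ * (Real.exp (1 / 2) + Real.exp (1 / 2)) := by
        rw [integral_const_mul, integral_add (h.integrable_exp_mul _) (h.integrable_exp_mul _)]
        gcongr
        · exact h1 _ rfl
        · exact h1 _ (by ring)
    _ = _ := by ring

/-- Replacing one coordinate by an independent copy preserves the product law. This permits
integrating first over a single row with the other rows frozen. -/
theorem measurePreserving_update_pi {ι : Type*} [Fintype ι] [DecidableEq ι] {α : Type*}
    [MeasurableSpace α] (μ : Measure α) [IsProbabilityMeasure μ] (i : ι) :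
    MeasurePreserving (fun p : (ι → α) × α => Function.update p.1 i p.2)
      ((Measure.pi fun _ => μ).prod μ) (Measure.pi fun _ => μ) := by
  have hm : Measurable (fun p : (ι → α) × α => Function.update p.1 i p.2) := by
    refine measurable_pi_iff.2 fun j => ?_
    by_cases h : j = i
    · subst h; simpa using measurable_snd
    · simp only [ne_eq, h, not_false_eq_true, Function.update_of_ne]
      exact (measurable_pi_apply j).comp measurable_fst
  refine ⟨hm, (Measure.pi_eq fun s hs => ?_).symm⟩
  rw [Measure.map_apply hm (.univ_pi hs)]
  have : (fun p : (ι → α) × α => Function.update p.1 i p.2) ⁻¹' (Set.univ.pi s) =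
      (Set.univ.pi (Function.update s i Set.univ)) ×ˢ s i := by
    ext p
    simp only [Set.mem_preimage, Set.mem_pi, Set.mem_univ, true_implies, Set.mem_prod]
    constructor
    · intro h
      refine ⟨fun j => ?_, by simpa using h i⟩
      by_cases hj : j = i
      · subst hj; simp
      · simpa [hj] using h j
    · rintro ⟨h, h'⟩ j
      by_cases hj : j = i
      · subst hj; simpa using h'
      · simpa [hj] using h j
  rw [this, Measure.prod_prod, Measure.pi_pi, ← Finset.mul_prod_erase _ _ (Finset.mem_univ i),
    ← Finset.mul_prod_erase _ (fun j => μ (s j)) (Finset.mem_univ i)]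
  rw [Finset.prod_congr rfl (g := fun j => μ (s j))]
  · simp [mul_comm]
  · intro j hj
    simp [Finset.ne_of_mem_erase hj]

/-! ### Concentration of quadratic forms under second moments -/

open scoped ComplexConjugate in
theorem integral_norm_sq_sum_of_orthonormal {Ω κ : Type*} [MeasurableSpace Ω] {μ : Measure Ω}
    (s : Finset κ) (y : κ → Ω → ℂ)
    (hi : ∀ p ∈ s, ∀ p' ∈ s, Integrable (fun ω => y p ω * conj (y p' ω)) μ)
    (ho : ∀ p ∈ s, ∫ ω, y p ω * conj (y p ω) ∂μ = 1)
    (ho' : ∀ p ∈ s, ∀ p' ∈ s, p ≠ p' → ∫ ω, y p ω * conj (y p' ω) ∂μ = 0) (a : κ → ℂ) :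
    Integrable (fun ω => ‖∑ p ∈ s, a p * y p ω‖ ^ 2) μ ∧
    ∫ ω, ‖∑ p ∈ s, a p * y p ω‖ ^ 2 ∂μ = ∑ p ∈ s, ‖a p‖ ^ 2 := by
  have key : ∀ ω, ((‖∑ p ∈ s, a p * y p ω‖ ^ 2 : ℝ) : ℂ) =
      ∑ p ∈ s, ∑ p' ∈ s, a p * conj (a p') * (y p ω * conj (y p' ω)) := by
    intro ω
    push_cast
    rw [← Complex.mul_conj', map_sum, Finset.sum_mul_sum]
    refine Finset.sum_congr rfl fun p _ => Finset.sum_congr rfl fun p' _ => ?_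
    rw [map_mul]
    ring
  have hint : Integrable (fun ω => ∑ p ∈ s, ∑ p' ∈ s, a p * conj (a p') * (y p ω * conj (y p' ω)))
      μ :=
    integrable_finsetSum _ fun p hp => integrable_finsetSum _ fun p' hp' =>
      (hi p hp p' hp').const_mul _
  refine ⟨?_, ?_⟩
  · have := hint.re
    refine this.congr (.of_forall fun ω => ?_)
    simp only [← key]
    exact Complex.ofReal_re _
  · rw [← Complex.ofReal_inj, ← integral_complex_ofReal]
    simp only [key]
    rw [integral_finsetSum _ fun p hp => integrable_finsetSum _ fun p' hp' =>
      (hi p hp p' hp').const_mul _]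
    push_cast
    refine Finset.sum_congr rfl fun p hp => ?_
    rw [integral_finsetSum _ fun p' hp' => (hi p hp p' hp').const_mul _]
    simp only [integral_const_mul]
    rw [Finset.sum_eq_single p (fun p' hp' h => by rw [ho' p hp p' hp' h.symm, mul_zero])
      (fun h => absurd hp h), ho p hp, Complex.mul_conj', mul_one]

/-- Uses `f ≤ (K + f² / K) / 2`, which gives the bound of the Cauchy–Schwarz inequality directly. -/
theorem integral_le_of_integral_sq_le {Ω : Type*} [MeasurableSpace Ω] {μ : Measure Ω}
    [IsProbabilityMeasure μ] {f : Ω → ℝ} (hm : AEStronglyMeasurable f μ) 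
    (hi : Integrable (fun ω => f ω ^ 2) μ) {K : ℝ} (hK : 0 < K) (h : ∫ ω, f ω ^ 2 ∂μ ≤ K ^ 2) :
    Integrable f μ ∧ ∫ ω, f ω ∂μ ≤ K := by
  have hfi : Integrable f μ := ((memLp_two_iff_integrable_sq hm).2 hi).integrable (by norm_num)
  refine ⟨hfi, ?_⟩
  calc ∫ ω, f ω ∂μ ≤ ∫ ω, (K + f ω ^ 2 / K) / 2 ∂μ := by
        refine integral_mono hfi (((integrable_const K).add (hi.div_const K)).div_const 2) fun ω => ?_
        have : 0 ≤ (f ω - K) ^ 2 / K := by positivity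
        have h2 : (f ω - K) ^ 2 / K = f ω ^ 2 / K - 2 * f ω + K := by field_simp; ring
        simp only
        linarith
    _ = (K + (∫ ω, f ω ^ 2 ∂μ) / K) / 2 := by
        rw [integral_div, integral_add (integrable_const _) (hi.div_const _), integral_div]
        simp
    _ ≤ (K + K ^ 2 / K) / 2 := by gcongr
    _ = K := by field_simp; ring

/-- A centred probability distribution on `ℂ` with unit variance. -/
structure IsStandardized (ν : Measure ℂ) : Prop where
  isProbabilityMeasure : IsProbabilityMeasure ν
  memLp : MemLp (fun z => z) 2 ν
  integral_eq_zero : ∫ z, z ∂ν = 0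
  integral_norm_sq : ∫ z, ‖z‖ ^ 2 ∂ν = 1

/-- The part of the second moment beyond the truncation level `C`. -/
noncomputable def secondMomentTail (ν : Measure ℂ) (C : ℝ) : ℝ := ∫ z, (‖z‖ ^ 2 - min (‖z‖ ^ 2) C) ∂ν

namespace IsStandardized

variable {ν : Measure ℂ} {ι : Type*} [Fintype ι]

theorem integrable_norm_sq (hν : IsStandardized ν) : Integrable (fun z => ‖z‖ ^ 2) ν :=
  (memLp_two_iff_integrable_sq_norm hν.memLp.aestronglyMeasurable).1 hν.memLp

theorem integral_trunc (hν : IsStandardized ν) (C : ℝ) (hC : 0 ≤ C) :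
    Integrable (fun z : ℂ => min (‖z‖ ^ 2) C) ν := by
  have := hν.isProbabilityMeasure
  refine integrable_of_measurable_of_abs_le (C := C) (by fun_prop) fun z => ?_
  rw [abs_of_nonneg (by positivity)]
  exact min_le_right _ _

theorem secondMomentTail_nonneg (ν : Measure ℂ) (C : ℝ) : 0 ≤ secondMomentTail ν C :=
  integral_nonneg fun z => by simp

theorem tendsto_secondMomentTail (hν : IsStandardized ν) :
    Tendsto (secondMomentTail ν) atTop (𝓝 0) := by
  have : Tendsto (secondMomentTail ν) atTop (𝓝 (∫ _, (0 : ℝ) ∂ν)) := by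
    refine tendsto_integral_filter_of_dominated_convergence (fun z => ‖z‖ ^ 2)
      (.of_forall fun C => by fun_prop) ?_ hν.integrable_norm_sq ?_
    · filter_upwards [eventually_ge_atTop 0] with C hC
      refine .of_forall fun z => ?_
      rw [Real.norm_of_nonneg (by simp)]
      have : 0 ≤ min (‖z‖ ^ 2) C := by positivity
      linarith
    · refine .of_forall fun z => tendsto_const_nhds.congr' ?_
      filter_upwards [eventually_ge_atTop (‖z‖ ^ 2)] with C hC
      simp [hC]
  simpa using this

open scoped ComplexConjugate in
/-- The factors of `x p.1 * conj (x p.2)`, seen as a product over all coordinates of `x`. -/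
noncomputable def pairFactor [DecidableEq ι] (p : ι × ι) (i : ι) (z : ℂ) : ℂ :=
  if i = p.1 then z else if i = p.2 then conj z else 1

omit [Fintype ι] in
theorem memLp_pairFactor [DecidableEq ι] (hν : IsStandardized ν) (p : ι × ι) (i : ι) :
    MemLp (pairFactor p i) 2 ν := by
  have := hν.isProbabilityMeasure
  unfold pairFactor
  by_cases h1 : i = p.1
  · simpa only [h1, if_true] using hν.memLp
  by_cases h2 : i = p.2
  · simp only [h1, if_false, ← h2, if_true]
    exact hν.memLp.star
  · simpa only [h1, h2, if_false] using memLp_const 1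

open scoped ComplexConjugate in
theorem prod_pairFactor [DecidableEq ι] {p : ι × ι} (hp : p.1 ≠ p.2) (x : ι → ℂ) :
    ∏ i, pairFactor p i (x i) = x p.1 * conj (x p.2) := by
  rw [Finset.prod_eq_mul p.1 p.2 hp (fun i _ hi => by simp [pairFactor, hi.1, hi.2]) (by simp)
    (by simp)]
  simp [pairFactor, hp.symm]

-- For distinct ordered pairs some index occurs exactly once among the four, and its factor has mean
-- zero. The ordering `p.1 < p.2` excludes swapped pairs, for which the possibly nonzero mean of
-- `z²` would enter.
open scoped ComplexConjugate in
theorem prod_integral_pairFactor [LinearOrder ι] (hν : IsStandardized ν) {p p' : ι × ι}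
    (hp : p.1 < p.2) (hp' : p'.1 < p'.2) :
    ∏ i, ∫ z, pairFactor p i z * conj (pairFactor p' i z) ∂ν = if p = p' then 1 else 0 := by
  have := hν.isProbabilityMeasure
  have hone : ∫ z, z * conj z ∂ν = 1 := by
    simp only [Complex.mul_conj']
    have := integral_complex_ofReal (μ := ν) (f := fun z : ℂ => ‖z‖ ^ 2)
    push_cast at this
    rw [this, hν.integral_norm_sq, Complex.ofReal_one]
  have hcz : ∫ z, conj z ∂ν = 0 := by
    rw [integral_conj, hν.integral_eq_zero, map_zero]
  split_ifs with h
  · subst h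
    refine Finset.prod_eq_one fun i _ => ?_
    by_cases h1 : i = p.1
    · simpa only [pairFactor, h1, if_true] using hone
    by_cases h2 : i = p.2
    · simp only [pairFactor, h2, hp.ne', if_false, if_true, Complex.conj_conj]
      simpa only [mul_comm] using hone
    · simp [pairFactor, h1, h2]
  · by_cases h1 : p.1 = p'.1 ∨ p.1 = p'.2
    · refine Finset.prod_eq_zero (Finset.mem_univ p.2) ?_
      have h2 : p.2 ≠ p'.1 := by
        rcases h1 with h1 | h1
        · rw [← h1]; exact hp.ne'
        · exact (hp'.trans (h1 ▸ hp)).ne'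
      have h3 : p.2 ≠ p'.2 := by
        rcases h1 with h1 | h1
        · exact fun h3 => h (Prod.ext h1 h3)
        · rw [← h1]; exact hp.ne'
      simpa [pairFactor, hp.ne', h2, h3] using hcz
    · push Not at h1
      refine Finset.prod_eq_zero (Finset.mem_univ p.1) ?_
      simpa [pairFactor, h1.1, h1.2] using hν.integral_eq_zero

open scoped ComplexConjugate in
theorem integral_prod_pairFactor [LinearOrder ι] (hν : IsStandardized ν) {p p' : ι × ι}
    (hp : p.1 < p.2) (hp' : p'.1 < p'.2) :
    Integrable (fun x : ι → ℂ => x p.1 * conj (x p.2) * conj (x p'.1 * conj (x p'.2)))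
      (Measure.pi fun _ => ν) ∧
    ∫ x : ι → ℂ, x p.1 * conj (x p.2) * conj (x p'.1 * conj (x p'.2)) ∂(Measure.pi fun _ => ν) =
      if p = p' then 1 else 0 := by
  have := hν.isProbabilityMeasure
  let G : ι → ℂ → ℂ := fun i z => pairFactor p i z * conj (pairFactor p' i z)
  have hG : ∀ i, Integrable (G i) ν := fun i =>
    (hν.memLp_pairFactor p i).integrable_mul (hν.memLp_pairFactor p' i).star
  have hpair : (fun x : ι → ℂ => x p.1 * conj (x p.2) * conj (x p'.1 * conj (x p'.2))) =
      fun x : ι → ℂ => ∏ i, G i (x i) := by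
    ext x
    rw [← prod_pairFactor hp.ne, ← prod_pairFactor hp'.ne, map_prod, ← Finset.prod_mul_distrib]
  have h1 : Integrable (fun x : ι → ℂ => ∏ i, G i (x i)) (Measure.pi fun _ => ν) :=
    Integrable.fintype_prod hG
  have h2 : ∫ x : ι → ℂ, ∏ i, G i (x i) ∂(Measure.pi fun _ => ν) = ∏ i, ∫ z, G i z ∂ν :=
    integral_fintype_prod_eq_prod G
  rw [hpair]
  exact ⟨h1, h2.trans (hν.prod_integral_pairFactor hp hp')⟩

open scoped ComplexConjugate in
theorem integral_norm_sq_sum_lt [LinearOrder ι] (hν : IsStandardized ν) (s : Finset (ι × ι))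
    (hs : ∀ p ∈ s, p.1 < p.2) (a : ι × ι → ℂ) :
    Integrable (fun x : ι → ℂ => ‖∑ p ∈ s, a p * (x p.1 * conj (x p.2))‖ ^ 2)
      (Measure.pi fun _ => ν) ∧
    ∫ x : ι → ℂ, ‖∑ p ∈ s, a p * (x p.1 * conj (x p.2))‖ ^ 2 ∂(Measure.pi fun _ => ν) =
      ∑ p ∈ s, ‖a p‖ ^ 2 := by
  have h1 : ∀ p ∈ s, ∀ p' ∈ s,
      Integrable (fun x : ι → ℂ => x p.1 * conj (x p.2) * conj (x p'.1 * conj (x p'.2)))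
      (Measure.pi fun _ => ν) := fun p hp p' hp' =>
    (hν.integral_prod_pairFactor (hs p hp) (hs p' hp')).1
  have h2 : ∀ p ∈ s, ∫ x : ι → ℂ, x p.1 * conj (x p.2) * conj (x p.1 * conj (x p.2))
      ∂(Measure.pi fun _ => ν) = 1 := fun p hp => by
    rw [(hν.integral_prod_pairFactor (hs p hp) (hs p hp)).2, if_pos rfl]
  have h3 : ∀ p ∈ s, ∀ p' ∈ s, p ≠ p' →
      ∫ x : ι → ℂ, x p.1 * conj (x p.2) * conj (x p'.1 * conj (x p'.2))
      ∂(Measure.pi fun _ => ν) = 0 := fun p hp p' hp' h => by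
    rw [(hν.integral_prod_pairFactor (hs p hp) (hs p' hp')).2, if_neg h]
  exact integral_norm_sq_sum_of_orthonormal (μ := Measure.pi fun _ : ι => ν) s
    (fun p x => x p.1 * conj (x p.2)) h1 h2 h3 a

/-- A weak law of large numbers in `L¹`. No fourth moment is available, so `‖x j‖²` is truncated at
`C`: the truncated sum is controlled by its variance, and the remainder and its mean by the tail of
the second moment, once each. -/
theorem integral_abs_diag_le (hν : IsStandardized ν) (h : ι → ℝ) {B C : ℝ} (hB : 0 < B) (hC : 0 < C)
    (hh : ∀ j, |h j| ≤ B) (hι : 0 < Fintype.card ι) :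
    Integrable (fun x : ι → ℂ => |∑ j, h j * (‖x j‖ ^ 2 - 1)|) (Measure.pi fun _ => ν) ∧
    ∫ x : ι → ℂ, |∑ j, h j * (‖x j‖ ^ 2 - 1)| ∂(Measure.pi fun _ => ν) ≤
      B * (C * √(Fintype.card ι) + 2 * Fintype.card ι * secondMomentTail ν C) := by
  have := hν.isProbabilityMeasure
  set π := Measure.pi fun _ : ι => ν
  set n : ℝ := (Fintype.card ι : ℝ) with hndef
  have hn : 0 < n := by simpa [n] using hι
  set g : ℂ → ℝ := fun z => min (‖z‖ ^ 2) C with hg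
  have hgi : Integrable g ν := hν.integral_trunc C hC.le
  have hgm : Measurable g := by fun_prop
  have hg0 : ∀ z, 0 ≤ g z := fun z => by positivity
  have hgC : ∀ z, g z ≤ C := fun z => min_le_right _ _
  set κ := secondMomentTail ν C with hκ
  have hκ' : κ = 1 - ∫ z, g z ∂ν := by
    rw [hκ, secondMomentTail, integral_sub hν.integrable_norm_sq hgi, hν.integral_norm_sq]
  have hκ0 : 0 ≤ κ := secondMomentTail_nonneg ν C
  have hev : ∀ j, MeasurePreserving (fun x : ι → ℂ => x j) π ν := fun j =>
    measurePreserving_eval (fun _ => ν) j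
  set S : (ι → ℂ) → ℝ := ∑ j, fun x => h j * g (x j) with hS
  have hSm : Measurable S := by
    rw [hS]; fun_prop
  have hLp : ∀ j, MemLp (fun z => h j * g z) 2 ν := fun j =>
    MemLp.of_bound (by fun_prop) (B * C) (.of_forall fun z => by
      rw [norm_mul, Real.norm_eq_abs, Real.norm_of_nonneg (hg0 z)]
      exact mul_le_mul (hh j) (hgC z) (hg0 z) hB.le)
  have hvar : Var[S; π] ≤ (B * C * √n) ^ 2 := by
    rw [hS, variance_sum_pi (X := fun j z => h j * g z) (μ := fun _ => ν) hLp]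
    have : ∀ j ∈ Finset.univ, Var[fun z => h j * g z; ν] ≤ (B * C) ^ 2 := by
      intro j _
      refine (variance_le_expectation_sq (hLp j).aestronglyMeasurable).trans ?_
      have hb : ∀ z, |((fun z => h j * g z) ^ 2) z| ≤ (B * C) ^ 2 := fun z => by
        simp only [Pi.pow_apply, abs_pow, abs_mul]
        rw [abs_of_nonneg (hg0 z)]
        have := abs_nonneg (h j)
        gcongr
        · exact hh j
        · exact hgC z
      exact (le_abs_self _).trans (abs_integral_le_of_abs_le hb)
    refine (Finset.sum_le_sum this).trans_eq ?_
    rw [Finset.sum_const, Finset.card_univ, nsmul_eq_mul, mul_pow _ (√n), Real.sq_sqrt hn.le, mul_comm]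
  have hSLp : MemLp S 2 π := by
    rw [hS]
    refine memLp_finsetSum' _ fun j _ => ?_
    exact (hLp j).comp_measurePreserving (hev j)
  have hSE : ∫ x, S x ∂π = ∑ j, h j * (1 - κ) := by
    rw [hS]
    simp only [Finset.sum_apply]
    rw [integral_finsetSum _ fun j _ => ?_]
    · refine Finset.sum_congr rfl fun j _ => ?_
      rw [integral_const_mul, hκ', sub_sub_cancel]
      congr 1
      have := (hev j).map_eq
      rw [← this, integral_map (hev j).measurable.aemeasurable hgm.aestronglyMeasurable]
    · exact ((hLp j).comp_measurePreserving (hev j)).integrable (by norm_num)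
  have hSvar : Integrable (fun x => |S x - ∫ x, S x ∂π|) π ∧
      ∫ x, |S x - ∫ x, S x ∂π| ∂π ≤ B * C * √n := by
    refine integral_le_of_integral_sq_le (by fun_prop) ?_ (by positivity) ?_
    · simp only [sq_abs]
      exact (hSLp.sub (memLp_const _)).integrable_sq
    · simp only [sq_abs]
      rw [variance_eq_integral hSm.aemeasurable] at hvar
      exact hvar
  have hri : ∀ j, Integrable (fun x : ι → ℂ => ‖x j‖ ^ 2 - g (x j)) π := fun j =>
    (hev j).integrable_comp_of_integrable (hν.integrable_norm_sq.sub hgi)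
  have hrE : ∀ j, ∫ x : ι → ℂ, (‖x j‖ ^ 2 - g (x j)) ∂π = κ := fun j => by
    rw [hκ, secondMomentTail, ← (hev j).map_eq,
      integral_map (hev j).measurable.aemeasurable (by fun_prop)]
  -- Centring the truncated part leaves the excess over the truncation and its mean `κ`; each
  -- contributes `n B κ` after integration.
  have hpt : ∀ x : ι → ℂ, |∑ j, h j * (‖x j‖ ^ 2 - 1)| ≤ |S x - ∫ x, S x ∂π| +
      (∑ j, B * (‖x j‖ ^ 2 - g (x j)) + n * (B * κ)) := by
    intro x
    have h1 : ∑ j, h j * (‖x j‖ ^ 2 - 1) = (S x - ∫ x, S x ∂π) +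
        (∑ j, h j * (‖x j‖ ^ 2 - g (x j)) + ∑ j, - (h j * κ)) := by
      rw [hSE, hS, Finset.sum_apply, ← Finset.sum_sub_distrib, ← Finset.sum_add_distrib,
        ← Finset.sum_add_distrib]
      exact Finset.sum_congr rfl fun j _ => by ring
    rw [h1]
    refine (abs_add_le _ _).trans (add_le_add_right ((abs_add_le _ _).trans (add_le_add ?_ ?_)) _)
    · refine (Finset.abs_sum_le_sum_abs _ _).trans (Finset.sum_le_sum fun j _ => ?_)
      have : 0 ≤ ‖x j‖ ^ 2 - g (x j) := by simp [g]
      rw [abs_mul, abs_of_nonneg this]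
      exact mul_le_mul_of_nonneg_right (hh j) this
    · refine (Finset.abs_sum_le_sum_abs _ _).trans ?_
      refine (Finset.sum_le_sum (g := fun _ => B * κ) fun j _ => ?_).trans_eq ?_
      · rw [abs_neg, abs_mul, abs_of_nonneg hκ0]
        exact mul_le_mul_of_nonneg_right (hh j) hκ0
      · simp [n]
  have hri' : Integrable (fun x : ι → ℂ => ∑ j, B * (‖x j‖ ^ 2 - g (x j))) π :=
    integrable_finsetSum _ fun j _ => (hri j).const_mul _
  have hbi : Integrable (fun x : ι → ℂ => |S x - ∫ x, S x ∂π| +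
      (∑ j, B * (‖x j‖ ^ 2 - g (x j)) + n * (B * κ))) π :=
    hSvar.1.add (hri'.add (integrable_const _))
  have hli : Integrable (fun x : ι → ℂ => |∑ j, h j * (‖x j‖ ^ 2 - 1)|) π :=
    hbi.mono' (Measurable.aestronglyMeasurable (by fun_prop))
      (.of_forall fun x => by simpa using hpt x)
  refine ⟨hli, (integral_mono hli hbi hpt).trans ?_⟩
  rw [integral_add (g := fun x : ι → ℂ => ∑ j, B * (‖x j‖ ^ 2 - g (x j)) + n * (B * κ)) hSvar.1
    (hri'.add (integrable_const (n * (B * κ)))),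
    integral_add hri' (integrable_const (n * (B * κ))), integral_finsetSum _ fun j _ => (hri j).const_mul _]
  simp only [integral_const_mul, hrE]
  simp only [Finset.sum_const, Finset.card_univ, nsmul_eq_mul, integral_const, probReal_univ,
    smul_eq_mul, one_mul]
  have := hSvar.2
  change _ + (n * (B * κ) + n * (B * κ)) ≤ _
  nlinarith

open scoped ComplexConjugate in
/-- Concentration of a Hermitian quadratic form in independent standardized variables around its
trace, assuming second moments only. -/
theorem integral_abs_quadForm_sub_trace_le [LinearOrder ι] (hν : IsStandardized ν)
    {H : Matrix ι ι ℂ} (hH : H.IsHermitian) {B C : ℝ} (hB : 0 < B) (hC : 0 < C)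
    (hd : ∀ j, |(H j j).re| ≤ B) (hr : ∀ j, ∑ k, ‖H k j‖ ^ 2 ≤ B ^ 2) (hι : 0 < Fintype.card ι) :
    Integrable (fun x : ι → ℂ => |∑ j, ∑ k, (H j k * (x j * conj (x k))).re - ∑ j, (H j j).re|)
      (Measure.pi fun _ => ν) ∧
    ∫ x : ι → ℂ, |∑ j, ∑ k, (H j k * (x j * conj (x k))).re - ∑ j, (H j j).re|
      ∂(Measure.pi fun _ => ν) ≤
      B * ((C + 2) * √(Fintype.card ι) + 2 * Fintype.card ι * secondMomentTail ν C) := by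
  have := hν.isProbabilityMeasure
  set n : ℝ := (Fintype.card ι : ℝ) with hndef
  have hn : 0 < n := by simpa [n] using hι
  -- The strict upper triangle suffices: by Hermitian symmetry the off-diagonal part is twice the
  -- real part of the sum over `s`, whence the `2` in `C + 2`.
  let s : Finset (ι × ι) := Finset.univ.filter fun p => p.1 < p.2
  have hs : ∀ p ∈ s, p.1 < p.2 := by simp [s]
  obtain ⟨hi2, he2⟩ := hν.integral_norm_sq_sum_lt s hs fun p => H p.1 p.2
  have hle : ∑ p ∈ s, ‖H p.1 p.2‖ ^ 2 ≤ (B * √n) ^ 2 := by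
    calc ∑ p ∈ s, ‖H p.1 p.2‖ ^ 2 ≤ ∑ p : ι × ι, ‖H p.1 p.2‖ ^ 2 :=
          Finset.sum_le_sum_of_subset_of_nonneg (Finset.subset_univ _) fun _ _ _ => by positivity
      _ = ∑ k, ∑ j, ‖H j k‖ ^ 2 := by rw [Fintype.sum_prod_type_right]
      _ ≤ ∑ k : ι, B ^ 2 := Finset.sum_le_sum fun k _ => hr k
      _ = _ := by
        rw [Finset.sum_const, Finset.card_univ, nsmul_eq_mul, mul_pow, Real.sq_sqrt hn.le, mul_comm]
  obtain ⟨hi1, he1⟩ := integral_le_of_integral_sq_le (μ := Measure.pi fun _ : ι => ν)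
    (f := fun x : ι → ℂ => ‖∑ p ∈ s, H p.1 p.2 * (x p.1 * conj (x p.2))‖)
    (Measurable.aestronglyMeasurable (by fun_prop)) hi2 (K := B * √n) (by positivity)
    (he2.trans_le hle)
  obtain ⟨hid, hed⟩ := hν.integral_abs_diag_le (fun j => (H j j).re) hB hC hd hι
  have hsplit : ∀ x : ι → ℂ, ∑ j, ∑ k, (H j k * (x j * conj (x k))).re - ∑ j, (H j j).re =
      ∑ j, (H j j).re * (‖x j‖ ^ 2 - 1) +
        2 * (∑ p ∈ s, H p.1 p.2 * (x p.1 * conj (x p.2))).re := by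
    intro x
    set F : ι → ι → ℝ := fun j k => (H j k * (x j * conj (x k))).re with hF
    have hsymm : ∀ j k, F j k = F k j := by
      intro j k
      simp only [hF]
      rw [← Complex.conj_re, map_mul, map_mul, Complex.conj_conj, ← hH.apply j k]
      simp only [Complex.star_def, Complex.conj_conj]
      ring_nf
    have hdiag : ∀ j, F j j = (H j j).re * ‖x j‖ ^ 2 := by
      intro j
      simp only [hF]
      rw [Complex.mul_conj', ← Complex.ofReal_pow, Complex.re_mul_ofReal]
    have hup : (∑ p ∈ s, H p.1 p.2 * (x p.1 * conj (x p.2))).re =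
        ∑ j, ∑ k, if j < k then F j k else 0 := by
      rw [Complex.re_sum, Finset.sum_filter, Fintype.sum_prod_type]
    have hlow : ∑ j, ∑ k, (if k < j then F j k else 0) = ∑ j, ∑ k, if j < k then F j k else 0 := by
      rw [Finset.sum_comm]
      refine Finset.sum_congr rfl fun j _ => Finset.sum_congr rfl fun k _ => ?_
      rw [hsymm]
    have htri : ∀ j k, F j k = (if j = k then F j k else 0) + (if j < k then F j k else 0) +
        (if k < j then F j k else 0) := by
      intro j k
      rcases lt_trichotomy j k with h | h | h
      · simp [h, h.ne, h.not_gt]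
      · simp [h]
      · simp [h, h.ne', h.not_gt]
    have hsum : ∑ j, ∑ k, F j k = ∑ j, (H j j).re * ‖x j‖ ^ 2 +
        2 * ∑ j, ∑ k, if j < k then F j k else 0 := by
      rw [Finset.sum_congr rfl fun j _ => Finset.sum_congr rfl fun k _ => htri j k]
      simp only [Finset.sum_add_distrib]
      rw [hlow]
      simp only [Finset.sum_ite_eq, Finset.mem_univ, if_true, hdiag]
      ring
    rw [hup, hsum]
    simp only [mul_sub, Finset.sum_sub_distrib, mul_one]
    ring
  have hpt : ∀ x : ι → ℂ, |∑ j, ∑ k, (H j k * (x j * conj (x k))).re - ∑ j, (H j j).re| ≤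
      |∑ j, (H j j).re * (‖x j‖ ^ 2 - 1)| +
        2 * ‖∑ p ∈ s, H p.1 p.2 * (x p.1 * conj (x p.2))‖ := by
    intro x
    rw [hsplit]
    refine (abs_add_le _ _).trans (add_le_add_right ?_ _)
    rw [abs_mul, abs_two]
    gcongr
    exact Complex.abs_re_le_norm _
  have hbi := hid.add (hi1.const_mul 2)
  have hli : Integrable (fun x : ι → ℂ =>
      |∑ j, ∑ k, (H j k * (x j * conj (x k))).re - ∑ j, (H j j).re|) (Measure.pi fun _ => ν) :=
    hbi.mono' (Measurable.aestronglyMeasurable (by fun_prop))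
      (.of_forall fun x => by simpa using hpt x)
  refine ⟨hli, (integral_mono hli hbi hpt).trans ?_⟩
  rw [integral_add' hid (hi1.const_mul 2), integral_const_mul]
  nlinarith

end IsStandardized

/-- Cramer's rule with nonvanishing determinant; it serves to make the block traces measurable in
the entries. -/
theorem Matrix.continuous_colResolvent_apply {X m n : Type*} [TopologicalSpace X] [Fintype m]
    [Fintype n] [DecidableEq n] {t : ℝ} (ht : 0 < t) {f : X → Matrix m n ℂ} (hf : Continuous f)
    (j k : n) : Continuous fun x => Matrix.colResolvent t (f x) j k := by
  have h1 : Continuous fun x => (f x).conjTranspose * f x + (t : ℂ) • (1 : Matrix n n ℂ) :=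
    (hf.matrix_conjTranspose.matrix_mul hf).add continuous_const
  simp only [colResolvent, inv_def, Ring.inverse_eq_inv', smul_apply, smul_eq_mul]
  refine (h1.matrix_det.inv₀ fun x => ?_).mul (h1.matrix_adjugate.matrix_elem j k)
  exact (isUnit_det_conjTranspose_mul_self_add ht (f x)).ne_zero

/-! ### Blocks of the dilated diagram and block traces -/

namespace YoungDiagram

variable (lam : YoungDiagram) (N : ℕ)

/-- The block of an index of the dilated diagram. -/
def blockOf {lam : YoungDiagram} {N : ℕ} (i : Fin (N * lam.length)) : Fin lam.length :=
  ⟨i / N, Nat.div_lt_of_lt_mul i.2⟩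

/-- The indices in a given block. -/
def block {lam : YoungDiagram} {N : ℕ} (b : Fin lam.length) : Finset (Fin (N * lam.length)) :=
  Finset.univ.filter fun i => blockOf i = b

theorem card_block (hN : 0 < N) (b : Fin lam.length) : (block (N := N) b).card = N := by
  have h : Finset.univ.image (fun k : Fin N => (⟨k + N * b, by
      have := k.2
      have := b.2
      nlinarith⟩ : Fin (N * lam.length))) = block b := by
    ext i
    simp only [block, Finset.mem_filter, Finset.mem_univ, true_and, Finset.mem_image, blockOf,
      Fin.ext_iff]
    constructor
    · rintro ⟨k, hk⟩
      rw [← hk, Nat.add_mul_div_left _ _ hN, Nat.div_eq_of_lt k.2, zero_add]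
    · intro h
      refine ⟨⟨i % N, Nat.mod_lt _ hN⟩, ?_⟩
      rw [← h]
      exact Nat.mod_add_div _ _
  rw [← h, Finset.card_image_of_injective, Finset.card_univ, Fintype.card_fin]
  intro k k' h
  simpa [Fin.ext_iff] using h

/-- The columns of the boxes of `lam` in a given row. -/
def neighbors {lam : YoungDiagram} (a : Fin lam.length) : Finset (Fin lam.length) :=
  Finset.univ.filter fun b => ((a : ℕ), (b : ℕ)) ∈ lam

variable {lam N}

theorem mem_dilate_iff_blockOf (hN : 0 < N) (i j : Fin (N * lam.length)) :
    ((i : ℕ), (j : ℕ)) ∈ lam.dilate N ↔ blockOf j ∈ neighbors (blockOf i) := by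
  rw [mem_dilate hN, neighbors, Finset.mem_filter]
  exact (and_iff_right (Finset.mem_univ _)).symm

theorem card_neighbors_le (a : Fin lam.length) : (neighbors a).card ≤ lam.length := by
  simpa using Finset.card_le_univ (neighbors a)

/-- The normalized random matrix of shape `N lam`. -/
noncomputable def scaledMatrix (lam : YoungDiagram) (N : ℕ)
    (x : Fin (N * lam.length) → Fin (N * lam.length) → ℂ) :
    Matrix (Fin (N * lam.length)) (Fin (N * lam.length)) ℂ :=
  Matrix.of fun i j => if ((i : ℕ), (j : ℕ)) ∈ lam.dilate N then ((√N)⁻¹ : ℝ) * x i j else 0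

/-- The normalized partial trace of the resolvent over a block. -/
noncomputable def blockTrace (t : ℝ)
    (A : Matrix (Fin (N * lam.length)) (Fin (N * lam.length)) ℂ) (b : Fin lam.length) : ℝ :=
  (N : ℝ)⁻¹ * ∑ j ∈ block b, (A.colResolvent t j j).re

theorem continuous_scaledMatrix : Continuous (scaledMatrix lam N) := by
  refine continuous_matrix fun i j => ?_
  simp only [scaledMatrix, Matrix.of_apply]
  split_ifs <;> fun_prop

theorem scaledMatrix_update (x : Fin (N * lam.length) → Fin (N * lam.length) → ℂ)
    (i : Fin (N * lam.length)) (r : Fin (N * lam.length) → ℂ) :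
    scaledMatrix lam N (Function.update x i r) = (scaledMatrix lam N x).updateRow i
      fun j => if ((i : ℕ), (j : ℕ)) ∈ lam.dilate N then ((√N)⁻¹ : ℝ) * r j else 0 := by
  ext k j
  by_cases h : k = i
  · subst h; simp [scaledMatrix]
  · simp [scaledMatrix, h]

variable {t : ℝ}

theorem measurable_blockTrace_scaledMatrix (ht : 0 < t) (b : Fin lam.length) :
    Measurable fun x => blockTrace t (scaledMatrix lam N x) b := by
  refine Continuous.measurable (continuous_const.mul (continuous_finsetSum _ fun j _ => ?_))
  exact Complex.continuous_re.comp
    (Matrix.continuous_colResolvent_apply ht continuous_scaledMatrix j j)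

theorem measurable_blockTrace_conjTranspose_scaledMatrix (ht : 0 < t) (b : Fin lam.length) :
    Measurable fun x => blockTrace t (scaledMatrix lam N x).conjTranspose b := by
  refine Continuous.measurable (continuous_const.mul (continuous_finsetSum _ fun j _ => ?_))
  exact Complex.continuous_re.comp
    (Matrix.continuous_colResolvent_apply ht continuous_scaledMatrix.matrix_conjTranspose j j)

theorem blockTrace_nonneg (ht : 0 < t)
    (A : Matrix (Fin (N * lam.length)) (Fin (N * lam.length)) ℂ) (b : Fin lam.length) :
    0 ≤ blockTrace t A b :=
  mul_nonneg (by positivity) (Finset.sum_nonneg fun j _ => A.colResolvent_diag_re_nonneg ht j)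

theorem blockTrace_le (hN : 0 < N) (ht : 0 < t)
    (A : Matrix (Fin (N * lam.length)) (Fin (N * lam.length)) ℂ) (b : Fin lam.length) :
    blockTrace t A b ≤ 1 / t := by
  have hN' : (0 : ℝ) < N := by exact_mod_cast hN
  have : ∑ j ∈ block b, (A.colResolvent t j j).re ≤ N * (1 / t) := by
    refine (Finset.sum_le_card_nsmul _ _ _ fun j _ => A.colResolvent_diag_re_le ht j).trans_eq ?_
    rw [card_block lam N hN, nsmul_eq_mul]
  rw [blockTrace, inv_mul_le_iff₀ hN']
  exact this

theorem abs_blockTrace_le (hN : 0 < N) (ht : 0 < t)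
    (A : Matrix (Fin (N * lam.length)) (Fin (N * lam.length)) ℂ) (b : Fin lam.length) :
    |blockTrace t A b| ≤ 1 / t := by
  rw [abs_of_nonneg (blockTrace_nonneg ht A b)]
  exact blockTrace_le hN ht A b

theorem abs_blockTrace_updateRow_sub_le (ht : 0 < t)
    (A : Matrix (Fin (N * lam.length)) (Fin (N * lam.length)) ℂ) (i : Fin (N * lam.length))
    (r r' : Fin (N * lam.length) → ℂ) (b : Fin lam.length) :
    |blockTrace t (A.updateRow i r) b - blockTrace t (A.updateRow i r') b| ≤ 1 / (t * N) := by
  rw [blockTrace, blockTrace, ← mul_sub, abs_mul, abs_of_nonneg (by positivity)]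
  refine (mul_le_mul_of_nonneg_left
    (A.colResolvent_updateRow_sum_abs_le ht i r r' (block b)) (by positivity)).trans_eq ?_
  rw [mul_one_div, inv_eq_one_div, div_div, mul_comm t]

end YoungDiagram

/-! ### The approximate fixed point equation for expected block traces -/

section ArrayLaw

open YoungDiagram

variable {lam : YoungDiagram} {N : ℕ} {t : ℝ} {ν : Measure ℂ}

/-- The law of the rows of an array of independent variables of law `ν`. -/
noncomputable abbrev arrayLaw (lam : YoungDiagram) (N : ℕ) (ν : Measure ℂ) :
    Measure (Fin (N * lam.length) → Fin (N * lam.length) → ℂ) :=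
  Measure.pi fun _ => Measure.pi fun _ => ν

/-- Whole rows are the independent coordinates: `N ℓ` of them, each with influence `1 / (t N)`, give
a variance proxy of order `1 / N`. -/
theorem hasSubgaussianMGF_blockTrace [IsProbabilityMeasure ν] (hN : 0 < N) (ht : 0 < t)
    (b : Fin lam.length) :
    HasSubgaussianMGF (fun x => blockTrace t (scaledMatrix lam N x) b -
      ∫ x, blockTrace t (scaledMatrix lam N x) b ∂(arrayLaw lam N ν))
      ((N * lam.length : ℕ) * (1 / (t * N)).toNNReal ^ 2) (arrayLaw lam N ν) := by
  refine hasSubgaussianMGF_pi_of_bounded_differences _ (measurable_blockTrace_scaledMatrix ht b)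
    (fun x => abs_blockTrace_le hN ht _ b) (by positivity) fun x i y y' => ?_
  rw [scaledMatrix_update, scaledMatrix_update]
  exact abs_blockTrace_updateRow_sub_le ht _ _ _ _ _

theorem integral_abs_blockTrace_sub_le [IsProbabilityMeasure ν] (hN : 0 < N) (ht : 0 < t)
    (hl : 0 < lam.length) (b : Fin lam.length) :
    ∫ x, |blockTrace t (scaledMatrix lam N x) b -
      ∫ x, blockTrace t (scaledMatrix lam N x) b ∂(arrayLaw lam N ν)| ∂(arrayLaw lam N ν) ≤
      2 * Real.exp (1 / 2) * (√(N * lam.length) / (t * N)) := by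
  have hN' : (0 : ℝ) < N := by exact_mod_cast hN
  have hl' : (0 : ℝ) < lam.length := by exact_mod_cast hl
  refine (hasSubgaussianMGF_blockTrace hN ht b).integral_abs_le (by positivity) ?_
  push_cast
  rw [Real.coe_toNNReal _ (by positivity), div_pow (√_), Real.sq_sqrt (by positivity), div_pow,
    one_pow, mul_one_div]

/-- The error in the approximate fixed point equation for the block traces. -/
noncomputable def fixedPointError (lam : YoungDiagram) (ν : Measure ℂ) (t C : ℝ) (N : ℕ) : ℝ :=
  (1 / t) * ((N : ℝ)⁻¹ * ((1 / t) * ((C + 2) * √(N * lam.length) +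
    2 * (N * lam.length) * secondMomentTail ν C)) + lam.length * (1 / (t * N)) +
    lam.length * (2 * Real.exp (1 / 2) * (√(N * lam.length) / (t * N))))

theorem abs_one_div_sub_one_div_le (ht : 0 < t) {p q : ℝ} (hp : 0 ≤ p) (hq : 0 ≤ q) :
    |1 / (t * (1 + p)) - 1 / (t * (1 + q))| ≤ 1 / t * |p - q| := by
  have h : 1 / (t * (1 + p)) - 1 / (t * (1 + q)) = 1 / t * ((q - p) / ((1 + p) * (1 + q))) := by
    field_simp
    ring
  rw [h, abs_mul, abs_of_pos (by positivity : 0 < 1 / t), abs_div, abs_sub_comm p q,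
    abs_of_pos (by positivity : 0 < (1 + p) * (1 + q))]
  gcongr
  exact div_le_self (abs_nonneg _) (by nlinarith)

-- The zeros of the row are moved into the coefficient matrix, so that the form becomes one in a
-- full vector of i.i.d. entries.
open scoped ComplexConjugate in
theorem resolventForm_star_eq_sum {n : Type*} [Fintype n] [DecidableEq n] (A : Matrix n n ℂ)
    (J : n → Prop) [DecidablePred J] (c : ℝ) (r : n → ℂ) :
    A.resolventForm t (star fun j => if J j then (c : ℂ) * r j else 0) =
      c ^ 2 * ∑ j, ∑ k, ((if J j ∧ J k then A.colResolvent t j k else 0) * (r j * conj (r k))).re := by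
  simp only [Matrix.resolventForm, star_star, dotProduct, Matrix.mulVec, Pi.star_apply]
  rw [Complex.re_sum, Finset.mul_sum]
  refine Finset.sum_congr rfl fun j _ => ?_
  rw [Finset.mul_sum, Complex.re_sum, Finset.mul_sum]
  refine Finset.sum_congr rfl fun k _ => ?_
  by_cases hj : J j <;> by_cases hk : J k <;> simp only [hj, hk, and_self, and_true, and_false,
    if_true, if_false, zero_mul, mul_zero, star_zero, Complex.zero_re]
  rw [← Complex.re_ofReal_mul]
  congr 1
  simp
  ring

-- The core estimate: with all rows but `i` frozen, the Schur complement formula turns the diagonal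
-- entry into a function of a quadratic form in the fresh row `r`, which concentrates around its
-- trace.
open scoped ComplexConjugate in
theorem integral_update_row_le (hν : IsStandardized ν) (hN : 0 < N) (ht : 0 < t) {C : ℝ} (hC : 0 < C)
    (i : Fin (N * lam.length)) (M : Fin lam.length → ℝ) (hM : ∀ b, 0 ≤ M b)
    (x : Fin (N * lam.length) → Fin (N * lam.length) → ℂ) :
    ∫ r, |((scaledMatrix lam N (Function.update x i r)).conjTranspose.colResolvent t i i).re -
      1 / (t * (1 + ∑ b ∈ neighbors (blockOf i), M b))| ∂(Measure.pi fun _ => ν) ≤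
    (1 / t) * ((N : ℝ)⁻¹ * ((1 / t) * ((C + 2) * √(N * lam.length) +
      2 * (N * lam.length) * secondMomentTail ν C)) + lam.length * (1 / (t * N)) +
      ∑ b, |blockTrace t (scaledMatrix lam N x) b - M b|) := by
  have := hν.isProbabilityMeasure
  have hN' : (0 : ℝ) < N := by exact_mod_cast hN
  set A₀ := (scaledMatrix lam N x).updateRow i 0 with hA₀
  set J : Fin (N * lam.length) → Prop := fun j => ((i : ℕ), (j : ℕ)) ∈ lam.dilate N with hJ
  set H := A₀.colResolvent t with hH
  -- Cutting `H` down to the columns met by row `i` keeps it Hermitian and keeps the bounds `1 / t`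
  -- on its diagonal and `1 / t²` on its columns. Its trace is the sum of the block traces over the
  -- neighbours of the block of `i`.
  let H' : Matrix (Fin (N * lam.length)) (Fin (N * lam.length)) ℂ := Matrix.of fun j k => if J j ∧ J k then H j k else 0
  set S : (Fin (N * lam.length) → ℂ) → ℝ := fun r => ∑ j, ∑ k, (H' j k * (r j * conj (r k))).re with hS
  set T : ℝ := ∑ j, (H' j j).re with hT
  have hq : ∀ r, ((scaledMatrix lam N (Function.update x i r)).conjTranspose.colResolvent t i i).re =
      1 / (t * (1 + (N : ℝ)⁻¹ * S r)) ∧ 0 ≤ (N : ℝ)⁻¹ * S r := by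
    intro r
    have h1 : A₀.resolventForm t (star (scaledMatrix lam N (Function.update x i r) i)) =
        (N : ℝ)⁻¹ * S r := by
      rw [scaledMatrix_update, Matrix.updateRow_self]
      rw [resolventForm_star_eq_sum A₀ J, inv_pow, Real.sq_sqrt hN'.le]
      rfl
    rw [Matrix.colResolvent_conjTranspose_diag ht, ← h1]
    refine ⟨?_, Matrix.resolventForm_nonneg ht _ _⟩
    rw [scaledMatrix_update, Matrix.updateRow_idem]
  have hT' : (N : ℝ)⁻¹ * T = ∑ b ∈ neighbors (blockOf i), blockTrace t A₀ b := by
    simp only [blockTrace]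
    rw [← Finset.mul_sum, hT]
    congr 1
    have : ∀ j, (H' j j).re = if blockOf j ∈ neighbors (blockOf i) then (H j j).re else 0 := by
      intro j
      simp only [H', Matrix.of_apply, and_self, hJ, mem_dilate_iff_blockOf hN]
      split_ifs <;> simp
    rw [Finset.sum_congr rfl fun j _ => this j]
    simp only [block, Finset.sum_filter]
    rw [Finset.sum_comm]
    exact Finset.sum_congr rfl fun j _ => by rw [Finset.sum_ite_eq]
  have hle : ∀ j k, ‖H' j k‖ ≤ ‖H j k‖ := fun j k => by
    simp only [H', Matrix.of_apply]
    split_ifs <;> simp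
  have hd : ∀ j, |(H' j j).re| ≤ 1 / t := fun j => by
    simp only [H', Matrix.of_apply]
    split_ifs
    · rw [abs_of_nonneg (A₀.colResolvent_diag_re_nonneg ht j)]
      exact A₀.colResolvent_diag_re_le ht j
    · simpa using ht.le
  have hr : ∀ j, ∑ k, ‖H' k j‖ ^ 2 ≤ (1 / t) ^ 2 := fun j => by
    rw [one_div_pow]
    refine le_trans (Finset.sum_le_sum fun k _ => ?_) (A₀.sum_norm_sq_colResolvent_le ht j)
    have := hle k j
    gcongr
  have hH' : H'.IsHermitian := by
    ext j k
    simp only [H', Matrix.conjTranspose_apply, Matrix.of_apply, and_comm (a := J k)]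
    split_ifs
    · exact Matrix.colResolvent_conj t A₀ k j
    · exact star_zero ℂ
  obtain ⟨hqi, hqe⟩ := hν.integral_abs_quadForm_sub_trace_le hH' (by positivity) hC hd hr
    (by rw [Fintype.card_fin]; exact i.pos)
  have hcard : (Fintype.card (Fin (N * lam.length)) : ℝ) = N * lam.length := by simp
  rw [hcard] at hqe
  set K : ℝ := lam.length * (1 / (t * N)) + ∑ b, |blockTrace t (scaledMatrix lam N x) b - M b| with hK
  have hbd : ∀ r, |((scaledMatrix lam N (Function.update x i r)).conjTranspose.colResolvent t i i).re -
      1 / (t * (1 + ∑ b ∈ neighbors (blockOf i), M b))| ≤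
      (1 / t) * ((N : ℝ)⁻¹ * |S r - T| + K) := by
    intro r
    rw [(hq r).1]
    refine (abs_one_div_sub_one_div_le ht (hq r).2 (Finset.sum_nonneg fun b _ => hM b)).trans ?_
    gcongr
    -- Three errors: fluctuation of the form around its trace, the effect of zeroing row `i`, and
    -- the deviation of the block traces from `M`.
    have h1 : (N : ℝ)⁻¹ * S r - ∑ b ∈ neighbors (blockOf i), M b = (N : ℝ)⁻¹ * (S r - T) +
        (∑ b ∈ neighbors (blockOf i), (blockTrace t A₀ b - blockTrace t (scaledMatrix lam N x) b) +
        ∑ b ∈ neighbors (blockOf i), (blockTrace t (scaledMatrix lam N x) b - M b)) := by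
      rw [mul_sub, hT', Finset.sum_sub_distrib, Finset.sum_sub_distrib]
      ring
    rw [h1]
    refine (abs_add_le _ _).trans (add_le_add ?_ ((abs_add_le _ _).trans (add_le_add ?_ ?_)))
    · rw [abs_mul, abs_of_nonneg (inv_nonneg.2 hN'.le)]
    · refine (Finset.abs_sum_le_sum_abs _ _).trans ?_
      refine (Finset.sum_le_card_nsmul _ _ (1 / (t * N)) fun b _ => ?_).trans ?_
      · have := abs_blockTrace_updateRow_sub_le ht (scaledMatrix lam N x) i 0
          (scaledMatrix lam N x i) b
        rwa [Matrix.updateRow_eq_self] at this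
      · rw [nsmul_eq_mul]
        gcongr
        exact card_neighbors_le _
    · refine (Finset.abs_sum_le_sum_abs _ _).trans ?_
      exact Finset.sum_le_sum_of_subset_of_nonneg (Finset.subset_univ _) fun _ _ _ => abs_nonneg _
  refine (integral_mono_of_nonneg (.of_forall fun r => abs_nonneg _)
    (((hqi.const_mul _).add (integrable_const K)).const_mul _) (.of_forall hbd)).trans ?_
  rw [integral_const_mul, integral_add' (hqi.const_mul _) (integrable_const K), integral_const_mul]
  simp only [integral_const, probReal_univ, one_smul]
  rw [add_assoc]
  gcongr

theorem integral_update_pi {ι α : Type*} [Fintype ι] [DecidableEq ι] [MeasurableSpace α]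
    (μ : Measure α) [IsProbabilityMeasure μ] (i : ι) {f : (ι → α) → ℝ}
    (hf : Integrable f (Measure.pi fun _ => μ)) :
    Integrable (fun x => ∫ r, f (Function.update x i r) ∂μ) (Measure.pi fun _ => μ) ∧
    ∫ x, f x ∂(Measure.pi fun _ => μ) =
      ∫ x, ∫ r, f (Function.update x i r) ∂μ ∂(Measure.pi fun _ => μ) := by
  have h := measurePreserving_update_pi μ i
  have hi : Integrable (fun p : (ι → α) × α => f (Function.update p.1 i p.2))
      ((Measure.pi fun _ => μ).prod μ) := h.integrable_comp_of_integrable hf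
  refine ⟨hi.integral_prod_left, ?_⟩
  rw [← integral_prod _ hi, ← integral_map (φ := fun p : (ι → α) × α => Function.update p.1 i p.2)
    h.measurable.aemeasurable (by rw [h.map_eq]; exact hf.aestronglyMeasurable), h.map_eq]

theorem abs_integral_blockTrace_conjTranspose_sub_le (hν : IsStandardized ν) (hN : 0 < N)
    (ht : 0 < t) {C : ℝ} (hC : 0 < C) (a : Fin lam.length) :
    |∫ x, blockTrace t (scaledMatrix lam N x).conjTranspose a ∂(arrayLaw lam N ν) -
      1 / (t * (1 + ∑ b ∈ neighbors a,
        ∫ x, blockTrace t (scaledMatrix lam N x) b ∂(arrayLaw lam N ν)))| ≤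
      fixedPointError lam ν t C N := by
  have := hν.isProbabilityMeasure
  have hN' : (0 : ℝ) < N := by exact_mod_cast hN
  set M : Fin lam.length → ℝ := fun b =>
    ∫ x, blockTrace t (scaledMatrix lam N x) b ∂(arrayLaw lam N ν) with hMdef
  have hM : ∀ b, 0 ≤ M b := fun b => integral_nonneg fun x => blockTrace_nonneg ht _ b
  set v := 1 / (t * (1 + ∑ b ∈ neighbors a, M b)) with hv
  set G : Fin (N * lam.length) → (Fin (N * lam.length) → Fin (N * lam.length) → ℂ) → ℝ :=
    fun i x => ((scaledMatrix lam N x).conjTranspose.colResolvent t i i).re with hG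
  have hGi : ∀ i, Integrable (G i) (arrayLaw lam N ν) := fun i => by
    refine integrable_of_measurable_of_abs_le (C := 1 / t) ?_ fun x => ?_
    · exact (Complex.continuous_re.comp (Matrix.continuous_colResolvent_apply ht
        continuous_scaledMatrix.matrix_conjTranspose i i)).measurable
    · rw [abs_of_nonneg (Matrix.colResolvent_diag_re_nonneg ht _ i)]
      exact Matrix.colResolvent_diag_re_le ht _ i
  have hbi : ∀ b, Integrable (fun x => |blockTrace t (scaledMatrix lam N x) b - M b|)
      (arrayLaw lam N ν) := fun b =>
    ((integrable_of_measurable_of_abs_le (measurable_blockTrace_scaledMatrix ht b)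
      fun x => abs_blockTrace_le hN ht _ b).sub (integrable_const _)).abs
  have hrow : ∀ i ∈ block a, |∫ x, G i x ∂(arrayLaw lam N ν) - v| ≤ fixedPointError lam ν t C N := by
    intro i hi
    have hia : blockOf i = a := by simpa [block] using hi
    have h1 : ∫ x, G i x ∂(arrayLaw lam N ν) - v = ∫ x, (G i x - v) ∂(arrayLaw lam N ν) := by
      rw [integral_sub (hGi i) (integrable_const v)]
      simp
    rw [h1]
    refine abs_integral_le_integral_abs.trans ?_
    -- Row `i` is resampled, so that the inner integral is the one bounded in
    -- `integral_update_row_le`; the outer integral leaves the concentration error of the block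
    -- traces.
    obtain ⟨h2, h3⟩ := integral_update_pi (Measure.pi fun _ => ν) i
      ((hGi i).sub (integrable_const v)).abs
    rw [fixedPointError]
    refine h3.trans_le ((integral_mono h2 (g := fun x => (1 / t) *
      ((N : ℝ)⁻¹ * ((1 / t) * ((C + 2) * √(N * lam.length) +
      2 * (N * lam.length) * secondMomentTail ν C)) + lam.length * (1 / (t * N)) +
      ∑ b, |blockTrace t (scaledMatrix lam N x) b - M b|)) ?_ fun x => ?_).trans ?_)
    rotate_left
    · have := integral_update_row_le hν hN ht hC i M hM x
      rw [hia] at this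
      exact this
    · rw [integral_const_mul, integral_add (integrable_const _)
        (integrable_finsetSum _ fun b _ => hbi b), integral_finsetSum _ fun b _ => hbi b]
      simp only [integral_const, probReal_univ, one_smul]
      gcongr
      refine (Finset.sum_le_card_nsmul _ _ _ fun b _ =>
        integral_abs_blockTrace_sub_le hN ht b.pos b).trans_eq ?_
      simp
    · exact ((integrable_const _).add (integrable_finsetSum _ fun b _ => hbi b)).const_mul _
  have hE : ∫ x, blockTrace t (scaledMatrix lam N x).conjTranspose a ∂(arrayLaw lam N ν) - v =
      (N : ℝ)⁻¹ * ∑ i ∈ block a, (∫ x, G i x ∂(arrayLaw lam N ν) - v) := by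
    simp only [blockTrace]
    rw [integral_const_mul, integral_finsetSum _ fun i _ => hGi i, Finset.sum_sub_distrib,
      Finset.sum_const, card_block lam N hN, nsmul_eq_mul, mul_sub, inv_mul_cancel_left₀ hN'.ne']
  rw [hE, abs_mul, abs_of_nonneg (inv_nonneg.2 hN'.le), inv_mul_le_iff₀ hN']
  refine (Finset.abs_sum_le_sum_abs _ _).trans ((Finset.sum_le_card_nsmul _ _ _ hrow).trans_eq ?_)
  rw [card_block lam N hN, nsmul_eq_mul]

end ArrayLaw

/-! ### Counting trees by cutting off the leftmost subtree -/

namespace LabelledPlaneTree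

variable {α : Type}

/-- Attach a new leftmost subtree at the root. -/
def graft (t : LabelledPlaneTree α) : LabelledPlaneTree α → LabelledPlaneTree α
  | node a ts => node a (t :: ts)

theorem graft_injective2 : Function.Injective2 (graft (α := α)) := by
  rintro t t' ⟨a, ts⟩ ⟨a', ts'⟩ h
  simp only [graft, node.injEq, List.cons.injEq] at h
  exact ⟨h.2.1, by rw [h.1, h.2.2]⟩

theorem rootLabel_graft (t s : LabelledPlaneTree α) : (graft t s).rootLabel = s.rootLabel := by
  cases s; rfl

theorem numVertices_graft (t s : LabelledPlaneTree α) :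
    (graft t s).numVertices = t.numVertices + s.numVertices := by
  cases s
  simp only [graft, numVertices_node, List.map_cons, List.sum_cons]
  omega

theorem isLambdaPlane_graft {lam : YoungDiagram} (t s : LabelledPlaneTree (Fin lam.length)) :
    (graft t s).IsLambdaPlane lam ↔
      (((s.rootLabel : ℕ), (t.rootLabel : ℕ)) ∈ lam ∧ ((t.rootLabel : ℕ), (s.rootLabel : ℕ)) ∈ lam) ∧
      t.IsLambdaPlane lam ∧ s.IsLambdaPlane lam := by
  obtain ⟨a, ts⟩ := s
  constructor
  · rintro ⟨_, _, hedge, hsub⟩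
    exact ⟨hedge t (by simp), hsub t (by simp), .node a ts (fun u hu => hedge u (by simp [hu]))
      fun u hu => hsub u (by simp [hu])⟩
  · rintro ⟨he, ht, ⟨_, _, hedge, hsub⟩⟩
    refine .node a (t :: ts) (fun u hu => ?_) fun u hu => ?_
    · rcases List.mem_cons.1 hu with rfl | hu
      · exact he
      · exact hedge u hu
    · rcases List.mem_cons.1 hu with rfl | hu
      · exact ht
      · exact hsub u hu

end LabelledPlaneTree

section RootedTrees

open LabelledPlaneTree YoungDiagram

variable {lam : YoungDiagram}

/-- The finite set of `lam`-plane trees with `k` edges and root label `a`. -/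
noncomputable def rootedTrees (a : Fin lam.length) (k : ℕ) :
    Finset (LabelledPlaneTree (Fin lam.length)) :=
  ((lambdaPlaneTrees_finite lam (k + 1)).subset
    (Set.inter_subset_left (t := {t | t.rootLabel = a}))).toFinset

theorem mem_rootedTrees {a : Fin lam.length} {k : ℕ} {t : LabelledPlaneTree (Fin lam.length)} :
    t ∈ rootedTrees a k ↔ t.numVertices = k + 1 ∧ t.IsLambdaPlane lam ∧ t.rootLabel = a := by
  simp [rootedTrees, lambdaPlaneTrees, and_assoc]

theorem lambdaCatalan_eq_sum (k : ℕ) :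
    lambdaCatalan lam k = ∑ a, (rootedTrees (lam := lam) a k).card := by
  classical
  rw [lambdaCatalan, Set.ncard_eq_toFinset_card _ (lambdaPlaneTrees_finite lam (k + 1)),
    Finset.card_eq_sum_card_fiberwise (f := rootLabel) (t := Finset.univ) (by simp)]
  refine Finset.sum_congr rfl fun a _ => congrArg _ ?_
  ext t
  simp [mem_rootedTrees, lambdaPlaneTrees, and_assoc]

theorem card_rootedTrees_zero (a : Fin lam.length) : (rootedTrees a 0).card = 1 := by
  rw [Finset.card_eq_one]
  refine ⟨node a [], ?_⟩
  ext ⟨b, ts⟩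
  rw [mem_rootedTrees, Finset.mem_singleton, numVertices_node]
  constructor
  · rintro ⟨h1, -, h2⟩
    have := length_le_sum ts
    have h3 : ts = [] := List.length_eq_zero_iff.1 (by omega)
    subst h3
    exact congrArg₂ _ h2 rfl
  · intro h
    simp only [node.injEq] at h
    obtain ⟨rfl, rfl⟩ := h
    exact ⟨by simp, .node b [] (by simp) (by simp), rfl⟩

theorem mem_swap_iff (hconj : lam.transpose = lam) (i j : ℕ) : (i, j) ∈ lam ↔ (j, i) ∈ lam := by
  conv_lhs => rw [← hconj]
  rw [YoungDiagram.mem_transpose]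
  rfl

/-- A tree with an edge is uniquely the grafting of its leftmost subtree onto the rest. The rest
keeps the root label `a`, the subtree has a neighbouring root label `b`, and one edge is used to
join them. -/
theorem card_rootedTrees_succ (hconj : lam.transpose = lam) (a : Fin lam.length) (k : ℕ) :
    (rootedTrees a (k + 1)).card = ∑ b ∈ neighbors a, ∑ p ∈ Finset.HasAntidiagonal.antidiagonal k,
      (rootedTrees b p.1).card * (rootedTrees a p.2).card := by
  rw [← Finset.sum_product']
  simp only [← Finset.card_product]
  rw [← Finset.card_sigma]
  symm
  refine Finset.card_bij (fun x _ => graft x.2.1 x.2.2) ?_ ?_ ?_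
  · rintro ⟨⟨b, i, j⟩, t, s⟩ h
    simp only [Finset.mem_sigma, Finset.mem_product, Finset.HasAntidiagonal.mem_antidiagonal, mem_rootedTrees,
      neighbors, Finset.mem_filter, Finset.mem_univ, true_and] at h
    obtain ⟨⟨hb, hij⟩, ⟨ht1, ht2, ht3⟩, hs1, hs2, hs3⟩ := h
    change graft t s ∈ rootedTrees a (k + 1)
    rw [mem_rootedTrees, numVertices_graft, isLambdaPlane_graft, rootLabel_graft, ht3, hs3]
    exact ⟨by omega, ⟨⟨hb, (mem_swap_iff hconj _ _).1 hb⟩, ht2, hs2⟩, rfl⟩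
  · rintro ⟨⟨b, i, j⟩, t, s⟩ h ⟨⟨b', i', j'⟩, t', s'⟩ h' heq
    simp only [Finset.mem_sigma, Finset.mem_product, Finset.HasAntidiagonal.mem_antidiagonal, mem_rootedTrees] at h h'
    obtain ⟨h5, h6⟩ := graft_injective2 heq
    dsimp only at h5 h6
    subst h5 h6
    obtain ⟨⟨-, hij⟩, ⟨ht1, -, ht3⟩, -⟩ := h
    obtain ⟨⟨-, hij'⟩, ⟨ht1', -, ht3'⟩, -⟩ := h'
    obtain rfl : b = b' := ht3.symm.trans ht3'
    obtain rfl : i = i' := by omega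
    obtain rfl : j = j' := by omega
    rfl
  · rintro ⟨a', ts⟩ h
    rw [mem_rootedTrees] at h
    obtain ⟨h1, h2, h3⟩ := h
    cases ts with
    | nil => simp [numVertices_node] at h1
    | cons t ts =>
      change (graft t (node a' ts)).IsLambdaPlane lam at h2
      change (graft t (node a' ts)).numVertices = _ at h1
      obtain rfl : a' = a := h3
      rw [numVertices_graft] at h1
      rw [isLambdaPlane_graft] at h2
      have ht := numVertices_pos t
      have hs := numVertices_pos (node a' ts)
      refine ⟨⟨⟨t.rootLabel, t.numVertices - 1, (node a' ts).numVertices - 1⟩, t, node a' ts⟩, ?_, rfl⟩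
      simp only [Finset.mem_sigma, Finset.mem_product, Finset.HasAntidiagonal.mem_antidiagonal, mem_rootedTrees,
        neighbors, Finset.mem_filter, Finset.mem_univ, true_and]
      exact ⟨⟨h2.1.1, by omega⟩, ⟨by omega, h2.2.1, trivial⟩, by omega, h2.2.2, rfl⟩

/-- Induction along the Catalan recursion, with at most `ℓ` choices of label for each edge. -/
theorem card_rootedTrees_le (hconj : lam.transpose = lam) (a : Fin lam.length) (k : ℕ) :
    (rootedTrees a k).card ≤ lam.length ^ k * catalan k := by
  induction k using Nat.strong_induction_on generalizing a with
  | _ k ih =>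
    cases k with
    | zero => simp [card_rootedTrees_zero]
    | succ k =>
      rw [card_rootedTrees_succ hconj, catalan_succ', pow_succ', mul_assoc]
      refine (Finset.sum_le_card_nsmul _ _ (lam.length ^ k * ∑ p ∈ Finset.HasAntidiagonal.antidiagonal k,
        catalan p.1 * catalan p.2) fun b _ => ?_).trans ?_
      · rw [Finset.mul_sum]
        refine Finset.sum_le_sum fun p hp => ?_
        have hp' := Finset.HasAntidiagonal.mem_antidiagonal.1 hp
        refine (Nat.mul_le_mul (ih p.1 (by omega) b) (ih p.2 (by omega) a)).trans_eq ?_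
        rw [← hp', pow_add]
        ring
      · rw [smul_eq_mul]
        exact Nat.mul_le_mul_right _ (card_neighbors_le a)

theorem card_rootedTrees_le_pow (hconj : lam.transpose = lam) (a : Fin lam.length) (k : ℕ) :
    ((rootedTrees a k).card : ℝ) ≤ (4 * lam.length : ℝ) ^ k := by
  have h1 : catalan k ≤ 4 ^ k := by
    rw [catalan_eq_centralBinom_div]
    refine (Nat.div_le_self _ _).trans ?_
    rw [Nat.centralBinom, show 4 = 2 ^ 2 by rfl, ← pow_mul]
    exact Nat.choose_le_two_pow _ _
  have h2 := (card_rootedTrees_le hconj a k).trans (Nat.mul_le_mul_left _ h1)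
  rw [← mul_pow, mul_comm] at h2
  exact_mod_cast h2

theorem lambdaCatalan_le (hconj : lam.transpose = lam) (k : ℕ) :
    (lambdaCatalan lam k : ℝ) ≤ lam.length * (4 * lam.length : ℝ) ^ k := by
  rw [lambdaCatalan_eq_sum, Nat.cast_sum]
  refine (Finset.sum_le_card_nsmul _ _ _ fun a _ => card_rootedTrees_le_pow hconj a k).trans_eq ?_
  simp

theorem lambdaCatalan_zero : lambdaCatalan lam 0 = lam.length := by
  simp [lambdaCatalan_eq_sum, card_rootedTrees_zero]

/-- The generating function of `lam`-plane trees with a given root label, at `-1 / t` and divided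
by `t`. -/
noncomputable def treeTransform (t : ℝ) (a : Fin lam.length) : ℝ :=
  1 / t * ∑' k, ((rootedTrees a k).card : ℝ) * (-1 / t) ^ k

/-! ### The tree generating functions solve the fixed point equation -/

section GeneratingFunction

variable {t : ℝ}

theorem abs_card_rootedTrees_mul_le (hconj : lam.transpose = lam) (ht : 8 * (lam.length : ℝ) ≤ t)
    (ht0 : 0 < t) (a : Fin lam.length) (k : ℕ) :
    |((rootedTrees a k).card : ℝ) * (-1 / t) ^ k| ≤ (1 / 2) ^ k := by
  rw [abs_mul, abs_pow, abs_div, abs_neg, abs_one, abs_of_pos ht0, Nat.abs_cast]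
  calc _ ≤ (4 * lam.length : ℝ) ^ k * (1 / t) ^ k := by
        gcongr
        exact card_rootedTrees_le_pow hconj a k
    _ = (4 * lam.length / t) ^ k := by rw [← mul_pow, mul_one_div]
    _ ≤ _ := by
        refine pow_le_pow_left₀ (by positivity) ?_ k
        rw [div_le_div_iff₀ ht0 two_pos]
        linarith

theorem summable_card_rootedTrees (hconj : lam.transpose = lam) (ht : 8 * (lam.length : ℝ) ≤ t)
    (ht0 : 0 < t) (a : Fin lam.length) :
    Summable fun k => ‖((rootedTrees a k).card : ℝ) * (-1 / t) ^ k‖ :=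
  Summable.of_nonneg_of_le (fun _ => norm_nonneg _)
    (fun k => abs_card_rootedTrees_mul_le hconj ht ht0 a k)
    (summable_geometric_of_lt_one (by norm_num) (by norm_num))

/-- The constant term `1` dominates the rest of the series, which is at most `∑ (1 / 2) ^ (k + 1) =
1` in absolute value. -/
theorem treeTransform_nonneg (hconj : lam.transpose = lam) (ht : 8 * (lam.length : ℝ) ≤ t)
    (ht0 : 0 < t) (a : Fin lam.length) : 0 ≤ treeTransform t a := by
  have hs := (summable_card_rootedTrees hconj ht ht0 a).of_norm
  have h1 : ‖∑' k, ((rootedTrees a (k + 1)).card : ℝ) * (-1 / t) ^ (k + 1)‖ ≤ 1 := by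
    refine tsum_of_norm_bounded (g := fun k => (1 / 2 : ℝ) ^ (k + 1)) ?_
      fun k => abs_card_rootedTrees_mul_le hconj ht ht0 a (k + 1)
    have := hasSum_geometric_two.mul_right (1 / 2)
    simpa [pow_succ] using this
  refine mul_nonneg (by positivity) ?_
  rw [hs.tsum_eq_zero_add, card_rootedTrees_zero]
  have := neg_le_of_abs_le h1
  simp only [Nat.cast_one, pow_zero, mul_one]
  linarith

/-- The recursion gives `G a = 1 - (1 / t) G a ∑ G b` for the series at `-1 / t`. Dividing by the
factor multiplying `G a` is legitimate by nonnegativity of the transforms. -/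
theorem treeTransform_eq (hconj : lam.transpose = lam) (ht : 8 * (lam.length : ℝ) ≤ t)
    (ht0 : 0 < t) (a : Fin lam.length) :
    treeTransform t a = 1 / (t * (1 + ∑ b ∈ neighbors a, treeTransform t b)) := by
  set f : Fin lam.length → ℕ → ℝ := fun a k => ((rootedTrees a k).card : ℝ) * (-1 / t) ^ k with hf
  have hs : ∀ a, Summable fun k => ‖f a k‖ := summable_card_rootedTrees hconj ht ht0
  have hrec : ∀ k, f a (k + 1) = (-1 / t) *
      ∑ b ∈ neighbors a, ∑ p ∈ Finset.HasAntidiagonal.antidiagonal k, f b p.1 * f a p.2 := by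
    intro k
    simp only [hf]
    rw [card_rootedTrees_succ hconj]
    push_cast
    rw [pow_succ', mul_left_comm, Finset.sum_mul]
    congr 1
    refine Finset.sum_congr rfl fun b _ => ?_
    rw [Finset.sum_mul]
    refine Finset.sum_congr rfl fun p hp => ?_
    rw [← Finset.HasAntidiagonal.mem_antidiagonal.1 hp, pow_add]
    ring
  have hG : ∑' k, f a k = 1 + (-1 / t) * ∑ b ∈ neighbors a, (∑' k, f b k) * ∑' k, f a k := by
    conv_lhs => rw [(hs a).of_norm.tsum_eq_zero_add]
    congr 1
    · simp [hf, card_rootedTrees_zero]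
    · rw [tsum_congr hrec, tsum_mul_left, Summable.tsum_finsetSum]
      · congr 1
        refine Finset.sum_congr rfl fun b _ => ?_
        rw [tsum_mul_tsum_eq_tsum_sum_antidiagonal_of_summable_norm (hs b) (hs a)]
      · intro b _
        exact (summable_norm_sum_mul_antidiagonal_of_summable_norm (hs b) (hs a)).of_norm
  have hpos : 0 ≤ ∑ b ∈ neighbors a, treeTransform t b :=
    Finset.sum_nonneg fun b _ => treeTransform_nonneg hconj ht ht0 b
  have hpos' : 0 < t * (1 + ∑ b ∈ neighbors a, treeTransform t b) := by positivity
  rw [eq_div_iff hpos'.ne']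
  simp only [treeTransform]
  rw [← Finset.mul_sum]
  rw [← Finset.sum_mul] at hG
  change 1 / t * (∑' k, f a k) * (t * (1 + 1 / t * ∑ b ∈ neighbors a, ∑' k, f b k)) = 1
  set G := ∑' k, f a k
  set Q := ∑ b ∈ neighbors a, ∑' k, f b k
  have : 1 / t * G * (t * (1 + 1 / t * Q)) = G + 1 / t * (Q * G) := by field_simp
  rw [this]
  linear_combination hG

end GeneratingFunction

end RootedTrees

/-! ### Almost sure convergence of the block traces -/

section StandardArray

open YoungDiagram

variable {lam : YoungDiagram} {Ω : Type*} [MeasurableSpace Ω] {P : Measure Ω}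

/-- An infinite array of i.i.d. centred complex random variables of unit variance. -/
structure IsStandardArray (P : Measure Ω) (X : ℕ → ℕ → Ω → ℂ) : Prop where
  measurable : ∀ i j, Measurable (X i j)
  iIndepFun : iIndepFun (fun p : ℕ × ℕ => X p.1 p.2) P
  identDistrib : ∀ i j, IdentDistrib (X i j) (X 0 0) P P
  memLp : MemLp (X 0 0) 2 P
  integral_eq_zero : ∫ ω, X 0 0 ω ∂P = 0
  integral_norm_sq : ∫ ω, ‖X 0 0 ω‖ ^ 2 ∂P = 1

namespace IsStandardArray

variable {X : ℕ → ℕ → Ω → ℂ}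

theorem isStandardized [IsProbabilityMeasure P] (hX : IsStandardArray P X) :
    IsStandardized (P.map (X 0 0)) where
  isProbabilityMeasure := Measure.isProbabilityMeasure_map (hX.measurable 0 0).aemeasurable
  memLp := (memLp_map_measure_iff (by fun_prop) (hX.measurable 0 0).aemeasurable).2 hX.memLp
  integral_eq_zero := by
    rw [integral_map (hX.measurable 0 0).aemeasurable (by fun_prop)]
    exact hX.integral_eq_zero
  integral_norm_sq := by
    rw [integral_map (hX.measurable 0 0).aemeasurable (by fun_prop)]
    exact hX.integral_norm_sq

open scoped ComplexConjugate in
theorem conjTranspose (hX : IsStandardArray P X) :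
    IsStandardArray P fun i j ω => conj (X j i ω) where
  measurable i j := Complex.continuous_conj.measurable.comp (hX.measurable j i)
  iIndepFun := (hX.iIndepFun.precomp Prod.swap_injective).comp (fun _ z => conj z)
    fun _ => Complex.continuous_conj.measurable
  identDistrib i j := (hX.identDistrib j i).comp Complex.continuous_conj.measurable
  memLp := hX.memLp.star
  integral_eq_zero := by rw [integral_conj, hX.integral_eq_zero, map_zero]
  integral_norm_sq := by simpa using hX.integral_norm_sq

/-- Independence is given over pairs of indices, while McDiarmid's inequality and the resampling
treat rows as coordinates; currying the product measure reconciles the two. -/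
theorem map_eq_arrayLaw [IsProbabilityMeasure P] (hX : IsStandardArray P X) (N : ℕ) :
    P.map (fun ω (i j : Fin (N * lam.length)) => X i j ω) = arrayLaw lam N (P.map (X 0 0)) := by
  have := hX.isStandardized.isProbabilityMeasure
  set n := N * lam.length
  have hinj : Function.Injective fun p : Fin n × Fin n => ((p.1 : ℕ), (p.2 : ℕ)) := by
    rintro ⟨i, j⟩ ⟨i', j'⟩ h
    simp only [Prod.mk.injEq, Fin.val_inj] at h
    exact Prod.ext h.1 h.2
  have h1 := (hX.iIndepFun.precomp hinj).map_fun_eq_infinitePi_map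
    (fun p : Fin n × Fin n => hX.measurable p.1 p.2)
  have h2 : ∀ p : Fin n × Fin n, P.map (X p.1 p.2) = P.map (X 0 0) :=
    fun p => (hX.identDistrib p.1 p.2).map_eq
  have h3 := Measure.infinitePi_map_curry (fun _ _ : Fin n => P.map (X 0 0))
  have hm : Measurable fun ω (p : Fin n × Fin n) => X p.1 p.2 ω :=
    measurable_pi_iff.2 fun p => hX.measurable p.1 p.2
  simp only [h2] at h1
  rw [← h1, Measure.map_map (MeasurableEquiv.measurable _) hm, Measure.infinitePi_eq_pi] at h3
  simp only [Measure.infinitePi_eq_pi] at h3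
  rw [arrayLaw, ← h3]
  rfl

theorem measurable_array (hX : IsStandardArray P X) (N : ℕ) :
    Measurable fun ω (i j : Fin (N * lam.length)) => X i j ω :=
  measurable_pi_iff.2 fun i => measurable_pi_iff.2 fun j => hX.measurable i j

theorem integral_arrayLaw [IsProbabilityMeasure P] (hX : IsStandardArray P X) (N : ℕ)
    {f : (Fin (N * lam.length) → Fin (N * lam.length) → ℂ) → ℝ} (hf : Measurable f) :
    ∫ x, f x ∂(arrayLaw lam N (P.map (X 0 0))) = ∫ ω, f (fun i j => X i j ω) ∂P := by
  rw [← hX.map_eq_arrayLaw, integral_map (hX.measurable_array N).aemeasurable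
    hf.aestronglyMeasurable]

end IsStandardArray

theorem tendsto_fixedPointError (ν : Measure ℂ) {t : ℝ} (C : ℝ) :
    Tendsto (fixedPointError lam ν t C) atTop
      (𝓝 (1 / t * (1 / t * (2 * lam.length * secondMomentTail ν C)))) := by
  have h1 : Tendsto (fun N : ℕ => √(N * lam.length) / N) atTop (𝓝 0) := by
    have h : Tendsto (fun N : ℕ => √lam.length * (√(N : ℝ))⁻¹) atTop (𝓝 (√lam.length * 0)) :=
      (tendsto_inv_atTop_zero.comp
        (Real.tendsto_sqrt_atTop.comp tendsto_natCast_atTop_atTop)).const_mul _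
    rw [mul_zero] at h
    refine h.congr fun N => ?_
    rw [Real.sqrt_mul (Nat.cast_nonneg _), mul_comm, mul_div_right_comm, Real.sqrt_div_self]
  have h2 : Tendsto (fun N : ℕ => (1 : ℝ) / N) atTop (𝓝 0) := tendsto_one_div_atTop_nhds_zero_nat
  have h3 : Tendsto (fun N : ℕ => (1 / t) * ((1 / t) * ((C + 2) * (√(N * lam.length) / N) +
      2 * lam.length * secondMomentTail ν C) + lam.length * (1 / t * (1 / N)) +
      lam.length * (2 * Real.exp (1 / 2) * (1 / t * (√(N * lam.length) / N))))) atTop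
      (𝓝 ((1 / t) * ((1 / t) * ((C + 2) * 0 +
      2 * lam.length * secondMomentTail ν C) + lam.length * (1 / t * 0) +
      lam.length * (2 * Real.exp (1 / 2) * (1 / t * 0))))) :=
    (((((h1.const_mul _).add_const _).const_mul _).add ((h2.const_mul _).const_mul _)).add
      (((h1.const_mul _).const_mul _).const_mul _)).const_mul _
  have h4 : (1 / t) * ((1 / t) * ((C + 2) * 0 +
      2 * lam.length * secondMomentTail ν C) + lam.length * (1 / t * 0) +
      lam.length * (2 * Real.exp (1 / 2) * (1 / t * 0))) =
      1 / t * (1 / t * (2 * lam.length * secondMomentTail ν C)) := by ring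
  rw [h4] at h3
  refine h3.congr' ?_
  filter_upwards [eventually_gt_atTop 0] with N hN
  have hN' : (N : ℝ) ≠ 0 := by positivity
  rw [fixedPointError]
  congr 2
  · congr 1
    · field_simp
    · rw [one_div_mul_one_div]
  · rw [div_mul_div_comm, one_mul]

/-- The order of choices matters: first `C` large to make the tail small, then `N` large to make `(C
+ 2) / √N` small. -/
theorem exists_fixedPointError_le {ν : Measure ℂ} (hν : IsStandardized ν) {t ε : ℝ} (hε : 0 < ε) :
    ∃ C : ℝ, 0 < C ∧ ∀ᶠ N in atTop, fixedPointError lam ν t C N ≤ ε := by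
  have h : Tendsto (fun C => 1 / t * (1 / t * (2 * lam.length * secondMomentTail ν C))) atTop
      (𝓝 (1 / t * (1 / t * (2 * lam.length * 0)))) :=
    ((hν.tendsto_secondMomentTail.const_mul _).const_mul _).const_mul _
  rw [mul_zero, mul_zero, mul_zero] at h
  obtain ⟨C, hC, hC0⟩ := ((h.eventually_lt_const hε).and (eventually_gt_atTop 0)).exists
  exact ⟨C, hC0, ((tendsto_fixedPointError ν C).eventually_lt_const hC).mono fun _ => le_of_lt⟩

/-- Stability of the fixed point equation of the tree transforms. -/
theorem sum_abs_sub_treeTransform_le (hconj : lam.transpose = lam) {t : ℝ}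
    (ht : 8 * (lam.length : ℝ) ≤ t) (ht0 : 0 < t) {e e' : Fin lam.length → ℝ} (he : ∀ a, 0 ≤ e a)
    (he' : ∀ a, 0 ≤ e' a) {ε : ℝ}
    (h1 : ∀ a, |e' a - 1 / (t * (1 + ∑ b ∈ neighbors a, e b))| ≤ ε)
    (h2 : ∀ a, |e a - 1 / (t * (1 + ∑ b ∈ neighbors a, e' b))| ≤ ε) :
    ∑ a, |e a - treeTransform t a| + ∑ a, |e' a - treeTransform t a| ≤ 4 * lam.length * ε := by
  have key : ∀ f f' : Fin lam.length → ℝ, (∀ a, 0 ≤ f a) →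
      (∀ a, |f' a - 1 / (t * (1 + ∑ b ∈ neighbors a, f b))| ≤ ε) →
      ∑ a, |f' a - treeTransform t a| ≤
        lam.length * ε + 1 / 2 * ∑ a, |f a - treeTransform t a| := by
    intro f f' hf h
    have h3 : ∀ a, |f' a - treeTransform t a| ≤
        ε + 1 / t * ∑ b, |f b - treeTransform t b| := by
      intro a
      refine (abs_sub_le _ (1 / (t * (1 + ∑ b ∈ neighbors a, f b))) _).trans (add_le_add (h a) ?_)
      rw [treeTransform_eq hconj ht ht0 a]
      refine (abs_one_div_sub_one_div_le ht0 (Finset.sum_nonneg fun b _ => hf b)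
        (Finset.sum_nonneg fun b _ => treeTransform_nonneg hconj ht ht0 b)).trans ?_
      gcongr
      rw [← Finset.sum_sub_distrib]
      refine (Finset.abs_sum_le_sum_abs _ _).trans ?_
      exact Finset.sum_le_sum_of_subset_of_nonneg (Finset.subset_univ _) fun _ _ _ => abs_nonneg _
    refine (Finset.sum_le_card_nsmul _ _ _ fun a _ => h3 a).trans ?_
    rw [Finset.card_univ, Fintype.card_fin, nsmul_eq_mul, mul_add, ← mul_assoc, mul_one_div]
    have : (0 : ℝ) ≤ lam.length := Nat.cast_nonneg _
    -- Each of the two maps contracts the `ℓ¹` distance by the factor `1 / 2`; adding both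
    -- inequalities absorbs half of the total and produces the constant `4 ℓ`.
    have h4 : lam.length / t ≤ 1 / 2 := by
      rw [div_le_div_iff₀ ht0 two_pos]
      linarith
    exact add_le_add_right (mul_le_mul_of_nonneg_right h4
      (Finset.sum_nonneg fun _ _ => abs_nonneg _)) _
  have := key e e' he h1
  have := key e' e he' h2
  linarith

-- Self-conjugacy of `lam` is what makes the family of matrices stable under conjugate
-- transposition.
open scoped ComplexConjugate in
theorem scaledMatrix_conj_swap (hconj : lam.transpose = lam) (N : ℕ) (hN : 0 < N) (x : ℕ → ℕ → ℂ) :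
    scaledMatrix lam N (fun i j => conj (x j i)) =
      (scaledMatrix lam N fun i j => x i j).conjTranspose := by
  ext i j
  have : (((i : ℕ), (j : ℕ)) ∈ lam.dilate N) = (((j : ℕ), (i : ℕ)) ∈ lam.dilate N) := by
    rw [mem_dilate hN, mem_dilate hN, mem_swap_iff hconj]
  simp only [scaledMatrix, Matrix.of_apply, Matrix.conjTranspose_apply, this]
  split_ifs <;> simp

namespace IsStandardArray

variable {X : ℕ → ℕ → Ω → ℂ} [IsProbabilityMeasure P]

/-- Row traces of one array are column traces of its conjugate transpose, so the approximate
equation applied to both arrays closes into a system for the pair `(e, e')`. -/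
theorem tendsto_integral_blockTrace (hX : IsStandardArray P X) (hconj : lam.transpose = lam)
    {t : ℝ} (ht : 8 * (lam.length : ℝ) ≤ t) (ht0 : 0 < t) (b : Fin lam.length) :
    Tendsto (fun N => ∫ x, blockTrace t (scaledMatrix lam N x) b ∂(arrayLaw lam N (P.map (X 0 0))))
      atTop (𝓝 (treeTransform t b)) := by
  have hl : (0 : ℝ) < lam.length := by exact_mod_cast b.pos
  set Y : ℕ → ℕ → Ω → ℂ := fun i j ω => (starRingEnd ℂ) (X j i ω) with hYdef
  have hY : IsStandardArray P Y := hX.conjTranspose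
  set ν := P.map (X 0 0)
  set ν' := P.map (Y 0 0)
  have hνX : IsStandardized ν := hX.isStandardized
  have hνY : IsStandardized ν' := hY.isStandardized
  set e : ℕ → Fin lam.length → ℝ := fun N b =>
    ∫ x, blockTrace t (scaledMatrix lam N x) b ∂(arrayLaw lam N ν) with he
  set e' : ℕ → Fin lam.length → ℝ := fun N b =>
    ∫ x, blockTrace t (scaledMatrix lam N x) b ∂(arrayLaw lam N ν') with he'
  have hXe : ∀ N, 0 < N → ∀ a,
      ∫ x, blockTrace t (scaledMatrix lam N x).conjTranspose a ∂(arrayLaw lam N ν) = e' N a := by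
    intro N hN a
    rw [hX.integral_arrayLaw N (measurable_blockTrace_conjTranspose_scaledMatrix ht0 a)]
    refine Eq.trans ?_ (hY.integral_arrayLaw N (measurable_blockTrace_scaledMatrix ht0 a)).symm
    refine integral_congr_ae (.of_forall fun ω => ?_)
    simp only [hYdef]
    rw [scaledMatrix_conj_swap hconj N hN fun i j => X i j ω]
  have hYe : ∀ N, 0 < N → ∀ a,
      ∫ x, blockTrace t (scaledMatrix lam N x).conjTranspose a ∂(arrayLaw lam N ν') = e N a := by
    intro N hN a
    rw [hY.integral_arrayLaw N (measurable_blockTrace_conjTranspose_scaledMatrix ht0 a)]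
    refine Eq.trans ?_ (hX.integral_arrayLaw N (measurable_blockTrace_scaledMatrix ht0 a)).symm
    refine integral_congr_ae (.of_forall fun ω => ?_)
    simp only [hYdef]
    rw [scaledMatrix_conj_swap hconj N hN fun i j => X i j ω, Matrix.conjTranspose_conjTranspose]
  rw [Metric.tendsto_nhds]
  intro ε hε
  obtain ⟨C, hC, h1⟩ := exists_fixedPointError_le (lam := lam) (t := t) hνX
    (show 0 < ε / (8 * lam.length) by positivity)
  obtain ⟨C', hC', h2⟩ := exists_fixedPointError_le (lam := lam) (t := t) hνY
    (show 0 < ε / (8 * lam.length) by positivity)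
  filter_upwards [h1, h2, eventually_gt_atTop 0] with N h1 h2 hN
  have h3 := sum_abs_sub_treeTransform_le hconj ht ht0 (e := e N) (e' := e' N)
    (fun a => integral_nonneg fun x => blockTrace_nonneg ht0 _ a)
    (fun a => integral_nonneg fun x => blockTrace_nonneg ht0 _ a)
    (fun a => by
      rw [← hXe N hN a]
      exact (abs_integral_blockTrace_conjTranspose_sub_le hνX hN ht0 hC a).trans h1)
    (fun a => by
      rw [← hYe N hN a]
      exact (abs_integral_blockTrace_conjTranspose_sub_le hνY hN ht0 hC' a).trans h2)
  have h4 : |e N b - treeTransform t b| ≤ ∑ a, |e N a - treeTransform t a| :=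
    Finset.single_le_sum (f := fun a => |e N a - treeTransform t a|) (fun _ _ => abs_nonneg _)
      (Finset.mem_univ b)
  have h5 : 0 ≤ ∑ a, |e' N a - treeTransform t a| := Finset.sum_nonneg fun _ _ => abs_nonneg _
  have h6 : 4 * lam.length * (ε / (8 * lam.length)) = ε / 2 := by field_simp; norm_num
  rw [Real.dist_eq]
  linarith

/-- The sub-Gaussian tails are exponentially small in `N`, and Borel–Cantelli applies. -/
theorem ae_tendsto_blockTrace_sub (hX : IsStandardArray P X) {t : ℝ} (ht0 : 0 < t)
    (b : Fin lam.length) :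
    ∀ᵐ ω ∂P, Tendsto (fun N => blockTrace t (scaledMatrix lam N fun i j => X i j ω) b -
      ∫ x, blockTrace t (scaledMatrix lam N x) b ∂(arrayLaw lam N (P.map (X 0 0)))) atTop (𝓝 0) := by
  have hl : (0 : ℝ) < lam.length := by exact_mod_cast b.pos
  have := hX.isStandardized.isProbabilityMeasure
  set Y : ℕ → Ω → ℝ := fun N ω => blockTrace t (scaledMatrix lam N fun i j => X i j ω) b -
      ∫ x, blockTrace t (scaledMatrix lam N x) b ∂(arrayLaw lam N (P.map (X 0 0))) with hY
  have hsub : ∀ N, 0 < N → HasSubgaussianMGF (Y N)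
      ((N * lam.length : ℕ) * (1 / (t * N)).toNNReal ^ 2) P := by
    intro N hN
    have h := hasSubgaussianMGF_blockTrace (ν := P.map (X 0 0)) hN ht0 b
    simp only [hY]
    generalize ∫ x, blockTrace t (scaledMatrix lam N x) b ∂(arrayLaw lam N (P.map (X 0 0))) = E
      at h ⊢
    rw [← hX.map_eq_arrayLaw] at h
    exact HasSubgaussianMGF.of_map (hX.measurable_array N).aemeasurable h
  have htail : ∀ ε : ℝ, 0 < ε → ∀ᵐ ω ∂P, ∀ᶠ N in atTop, |Y N ω| < ε := by
    intro ε hε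
    -- The Chernoff exponent `ε² / (2 σ²)` for the variance proxy `σ² = ℓ / (t² N)` equals `c N`.
    set c : ℝ := ε ^ 2 * t ^ 2 / (2 * lam.length) with hc
    have hc0 : 0 < c := by positivity
    have hbound : ∀ N, P {ω | ε ≤ |Y (N + 1) ω|} ≤
        ENNReal.ofReal (2 * Real.exp (-c) ^ (N + 1)) := by
      intro N
      have hN : 0 < N + 1 := N.succ_pos
      have hN' : (0 : ℝ) < (N + 1 : ℕ) := by exact_mod_cast hN
      have hexp : Real.exp (-ε ^ 2 / (2 * (((N + 1) * lam.length : ℕ) *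
          (1 / (t * (N + 1 : ℕ))).toNNReal ^ 2 : NNReal))) = Real.exp (-c) ^ (N + 1) := by
        rw [← Real.exp_nat_mul]
        congr 1
        push_cast
        rw [Real.coe_toNNReal _ (by positivity), hc]
        push_cast at hN'
        field_simp
      have h1 := (hsub _ hN).measure_ge_le hε.le
      have h2 := (hsub _ hN).neg.measure_ge_le hε.le
      rw [hexp] at h1 h2
      have hsubset : {ω | ε ≤ |Y (N + 1) ω|} ⊆ {ω | ε ≤ Y (N + 1) ω} ∪ {ω | ε ≤ (-Y (N + 1)) ω} :=
        fun ω hω => by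
          simp only [Set.mem_ofPred_eq, Set.mem_union, Pi.neg_apply] at hω ⊢
          exact le_abs.1 hω
      rw [← ofReal_measureReal]
      apply ENNReal.ofReal_le_ofReal
      refine (measureReal_mono hsubset).trans ((measureReal_union_le _ _).trans ?_)
      linarith
    have hsum : ∑' N, P {ω | ε ≤ |Y (N + 1) ω|} ≠ ⊤ := by
      refine ne_top_of_le_ne_top ?_ (ENNReal.tsum_le_tsum hbound)
      refine Summable.tsum_ofReal_ne_top ?_
      refine (((summable_nat_add_iff 1).2 (summable_geometric_of_lt_one (Real.exp_pos (-c)).le ?_)).mul_left 2)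
      rw [Real.exp_lt_one_iff]
      linarith
    filter_upwards [ae_eventually_notMem hsum] with ω hω
    obtain ⟨M, hM⟩ := eventually_atTop.1 hω
    filter_upwards [eventually_ge_atTop (M + 1)] with N hN
    obtain ⟨K, rfl⟩ : ∃ K, N = K + 1 := ⟨N - 1, by omega⟩
    exact not_le.1 (hM K (by omega))
  have hall : ∀ᵐ ω ∂P, ∀ m : ℕ, ∀ᶠ N in atTop, |Y N ω| < 1 / ((m : ℝ) + 1) :=
    ae_all_iff.2 fun m => htail _ (by positivity)
  filter_upwards [hall] with ω hω
  rw [Metric.tendsto_nhds]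
  intro ε hε
  obtain ⟨m, hm⟩ := exists_nat_one_div_lt hε
  filter_upwards [hω m] with N hN
  rw [Real.dist_0_eq_abs]
  exact hN.trans hm

/-- Only integer parameters are used, so that a single null set serves all of them. -/
theorem ae_tendsto_blockTrace (hX : IsStandardArray P X) (hconj : lam.transpose = lam) :
    ∀ᵐ ω ∂P, ∀ k : ℕ, 8 * lam.length ≤ k → 0 < k → ∀ b : Fin lam.length,
      Tendsto (fun N => blockTrace k (scaledMatrix lam N fun i j => X i j ω) b) atTop
        (𝓝 (treeTransform (k : ℝ) b)) := by
  simp only [ae_all_iff]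
  intro k hk hk0 b
  filter_upwards [hX.ae_tendsto_blockTrace_sub (t := k) (by exact_mod_cast hk0) b] with ω hω
  have := hω.add (hX.tendsto_integral_blockTrace hconj (t := k) (by exact_mod_cast hk)
    (by exact_mod_cast hk0) b)
  simpa using this

end IsStandardArray

end StandardArray

/-! ### Measures determined by their moments -/

/-- A probability measure whose moments are dominated by `R ^ k` lives on `[-R, R]`. -/
theorem ae_abs_le_of_moments_le {F : Measure ℝ} [IsProbabilityMeasure F] {R : ℝ} (hR : 0 < R)
    (hi : ∀ k : ℕ, Integrable (fun s : ℝ => s ^ k) F) (hm : ∀ k : ℕ, ∫ s, s ^ k ∂F ≤ R ^ k) :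
    ∀ᵐ s ∂F, |s| ≤ R := by
  have h : ∀ m : ℕ, ∀ᵐ s ∂F, |s| < R + 1 / ((m : ℝ) + 1) := by
    intro m
    set r := R + 1 / ((m : ℝ) + 1) with hr
    have hm0 : 0 < 1 / ((m : ℝ) + 1) := by positivity
    have hr0 : 0 < r := by positivity
    -- Markov's inequality for the even moment `2k`; since `r > R`, letting `k → ∞` removes all mass
    -- outside.
    have hbound : ∀ k : ℕ, F.real {s | r ≤ |s|} ≤ ((R / r) ^ 2) ^ k := by
      intro k
      have h1 := mul_meas_ge_le_integral_of_nonneg (μ := F) (f := fun s : ℝ => s ^ (2 * k))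
        (.of_forall fun s => by simp only [Pi.zero_apply, pow_mul]; positivity) (hi _) (r ^ (2 * k))
      have h2 : {s : ℝ | r ≤ |s|} ⊆ {s : ℝ | r ^ (2 * k) ≤ s ^ (2 * k)} := by
        intro s hs
        simp only [Set.mem_ofPred_eq] at hs ⊢
        calc r ^ (2 * k) ≤ |s| ^ (2 * k) := by gcongr
          _ = s ^ (2 * k) := by rw [pow_mul, sq_abs, ← pow_mul]
      have h3 := measureReal_mono (μ := F) h2
      rw [← pow_mul, div_pow, le_div_iff₀ (by positivity), mul_comm]
      calc _ ≤ r ^ (2 * k) * F.real {s : ℝ | r ^ (2 * k) ≤ s ^ (2 * k)} := by gcongr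
        _ ≤ _ := h1.trans (hm _)
    have hlt : (R / r) ^ 2 < 1 := by
      refine pow_lt_one₀ (by positivity) ?_ two_ne_zero
      rw [div_lt_one hr0]
      linarith
    have h0 : F.real {s | r ≤ |s|} ≤ 0 :=
      ge_of_tendsto (tendsto_pow_atTop_nhds_zero_of_lt_one (by positivity) hlt)
        (.of_forall hbound)
    have h1 : F.real {s | r ≤ |s|} = 0 := le_antisymm h0 measureReal_nonneg
    rw [measureReal_eq_zero_iff] at h1
    rw [ae_iff]
    simpa only [not_lt] using h1
  filter_upwards [ae_all_iff.2 h] with s hs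
  refine le_of_forall_pos_le_add fun ε hε => ?_
  obtain ⟨m, hm⟩ := exists_nat_one_div_lt hε
  exact (hs m).le.trans (by linarith)

/-- The exponential series is integrated termwise, dominated by `(|t| R) ^ k / k!` thanks to the
bounded support. -/
theorem hasSum_charFun_of_moments {F : Measure ℝ} [IsProbabilityMeasure F] {R : ℝ}
    (hs : ∀ᵐ s ∂F, |s| ≤ R) (t : ℝ) :
    HasSum (fun k : ℕ => ((t * Complex.I) ^ k / (k.factorial : ℂ)) * ((∫ s, s ^ k ∂F : ℝ) : ℂ))
      (charFun F t) := by
  rw [charFun_apply_real]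
  have h := hasSum_integral_of_dominated_convergence (μ := F)
    (F := fun (k : ℕ) (x : ℝ) => ((t : ℂ) * x * Complex.I) ^ k / (k.factorial : ℂ))
    (f := fun x : ℝ => Complex.exp ((t : ℂ) * x * Complex.I))
    (fun k _ => (|t| * R) ^ k / k.factorial) (fun k => by
      refine Continuous.aestronglyMeasurable ?_
      fun_prop) ?_ ?_ (integrable_const _) ?_
  · refine (funext fun k => ?_ : (fun k : ℕ => ((t * Complex.I) ^ k / (k.factorial : ℂ)) *
      ((∫ s, s ^ k ∂F : ℝ) : ℂ)) = _) ▸ h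
    rw [← integral_complex_ofReal, ← integral_const_mul]
    refine integral_congr_ae (.of_forall fun x => ?_)
    push_cast
    ring
  · intro k
    filter_upwards [hs] with x hx
    rw [norm_div, norm_pow, norm_mul, norm_mul, Complex.norm_I, mul_one, Complex.norm_real,
      Complex.norm_real, Complex.norm_natCast, Real.norm_eq_abs, Real.norm_eq_abs]
    gcongr
  · exact .of_forall fun x => Real.summable_pow_div_factorial _
  · refine .of_forall fun x => ?_
    rw [Complex.exp_eq_exp_ℂ]
    exact NormedSpace.expSeries_div_hasSum_exp _

theorem eq_of_moments_eq {F G : Measure ℝ} [IsProbabilityMeasure F] [IsProbabilityMeasure G] {R : ℝ}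
    (hR : 0 < R) {c : ℕ → ℝ} (hc : ∀ k, c k ≤ R ^ k)
    (hF : ∀ k : ℕ, Integrable (fun s : ℝ => s ^ k) F ∧ ∫ s, s ^ k ∂F = c k)
    (hG : ∀ k : ℕ, Integrable (fun s : ℝ => s ^ k) G ∧ ∫ s, s ^ k ∂G = c k) : F = G := by
  refine Measure.ext_of_charFun (funext fun t => ?_)
  have h1 := hasSum_charFun_of_moments (ae_abs_le_of_moments_le hR (fun k => (hF k).1)
    fun k => (hF k).2.trans_le (hc k)) t
  have h2 := hasSum_charFun_of_moments (ae_abs_le_of_moments_le hR (fun k => (hG k).1)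
    fun k => (hG k).2.trans_le (hc k)) t
  simp only [fun k => (hF k).2] at h1
  simp only [fun k => (hG k).2] at h2
  exact h1.unique h2

/-! ### Recovering moments from the Stieltjes transform -/

section Stieltjes

/-- The shifted generating function of a sequence, at `-1 / t`. -/
noncomputable def shiftedSeries (c : ℕ → ℝ) (k : ℕ) (t : ℝ) : ℝ := ∑' j, c (k + j) * (-1 / t) ^ j

variable {c : ℕ → ℝ} {R t : ℝ}

theorem abs_shifted_term_le (hR : 0 < R) (hc : ∀ k, |c k| ≤ R ^ k) (ht : 2 * R ≤ t) (k j : ℕ) :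
    ‖c (k + j) * (-1 / t) ^ j‖ ≤ R ^ k * (1 / 2) ^ j := by
  have ht0 : 0 < t := by linarith
  rw [Real.norm_eq_abs, abs_mul, abs_pow, abs_div, abs_neg, abs_one, abs_of_pos ht0]
  calc _ ≤ R ^ (k + j) * (1 / t) ^ j := by
        gcongr
        exact hc _
    _ = R ^ k * (R / t) ^ j := by rw [pow_add, mul_assoc, ← mul_pow, mul_one_div]
    _ ≤ _ := by
        have h : R / t ≤ 1 / 2 := by
          rw [div_le_div_iff₀ ht0 two_pos]
          linarith
        exact mul_le_mul_of_nonneg_left (pow_le_pow_left₀ (by positivity) h j) (by positivity)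

theorem abs_shiftedSeries_le (hR : 0 < R) (hc : ∀ k, |c k| ≤ R ^ k) (ht : 2 * R ≤ t) (k : ℕ) :
    |shiftedSeries c k t| ≤ R ^ k * 2 :=
  tsum_of_norm_bounded (hasSum_geometric_two.mul_left (R ^ k)) (abs_shifted_term_le hR hc ht k)

theorem shiftedSeries_eq (hR : 0 < R) (hc : ∀ k, |c k| ≤ R ^ k) (ht : 2 * R ≤ t) (k : ℕ) :
    shiftedSeries c k t = c k - 1 / t * shiftedSeries c (k + 1) t := by
  have hs : Summable fun j => c (k + j) * (-1 / t) ^ j :=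
    Summable.of_norm_bounded (summable_geometric_two.mul_left (R ^ k))
      (abs_shifted_term_le hR hc ht k)
  rw [shiftedSeries, hs.tsum_eq_zero_add, shiftedSeries, ← tsum_mul_left, sub_eq_add_neg, ← tsum_neg]
  congr 1
  · simp
  · refine tsum_congr fun j => ?_
    rw [pow_succ, show k + (j + 1) = k + 1 + j by omega]
    ring

theorem tendsto_shiftedSeries (hR : 0 < R) (hc : ∀ k, |c k| ≤ R ^ k) {T : ℕ} (hT : 2 * R ≤ T)
    (k : ℕ) : Tendsto (fun n : ℕ => shiftedSeries c k ((n + T : ℕ) : ℝ)) atTop (𝓝 (c k)) := by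
  have hT0 : (0 : ℝ) < T := by linarith
  have h1 : Tendsto (fun n : ℕ => R ^ (k + 1) * 2 * (1 / ((n + T : ℕ) : ℝ))) atTop
      (𝓝 (R ^ (k + 1) * 2 * 0)) :=
    ((tendsto_add_atTop_iff_nat (f := fun n : ℕ => (1 : ℝ) / n) T).2
      tendsto_one_div_atTop_nhds_zero_nat).const_mul _
  rw [mul_zero] at h1
  rw [tendsto_iff_dist_tendsto_zero]
  refine squeeze_zero (fun _ => dist_nonneg) (fun n => ?_) h1
  have ht : 2 * R ≤ ((n + T : ℕ) : ℝ) := by push_cast; have : (0:ℝ) ≤ n := Nat.cast_nonneg n; linarith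
  rw [shiftedSeries_eq hR hc ht k, Real.dist_eq, sub_sub_cancel_left, abs_neg, abs_mul,
    abs_of_nonneg (by positivity), mul_comm]
  gcongr
  exact abs_shiftedSeries_le hR hc ht _

variable {F : Measure ℝ} [IsProbabilityMeasure F]

/-- A measure whose Stieltjes transform has the asymptotic expansion with coefficients `c` has
moments `c`. -/
theorem moments_of_stieltjes (hR : 0 < R) (hc : ∀ k, |c k| ≤ R ^ k) {T : ℕ} (hT : 2 * R ≤ T)
    (h : ∀ t : ℕ, T ≤ t → ∫ x, 1 / (|x| + t) ∂F = 1 / t * shiftedSeries c 0 t) (k : ℕ) :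
    Integrable (fun x : ℝ => |x| ^ k) F ∧ ∫ x, |x| ^ k ∂F = c k := by
  have hT0 : 0 < T := by
    have : (0 : ℝ) < T := by linarith
    exact_mod_cast this
  -- The weight `t / (|x| + t)` tends to `1`, so the weighted integrals converge to the plain moment
  -- while their values tend to `c k`.
  have step : ∀ k, (∀ t : ℕ, T ≤ t → Integrable (fun x : ℝ => |x| ^ k * (t / (|x| + t))) F ∧
      ∫ x, |x| ^ k * (t / (|x| + t)) ∂F = shiftedSeries c k t) →
      Integrable (fun x : ℝ => |x| ^ k) F ∧ ∫ x, |x| ^ k ∂F = c k := by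
    intro k hk
    have hT' : ∀ n : ℕ, (0 : ℝ) < ((n + T : ℕ) : ℝ) := fun n => by
      have : 0 < n + T := by omega
      exact_mod_cast this
    have hle : ∀ (n : ℕ) (x : ℝ), ((n + T : ℕ) : ℝ) / (|x| + ((n + T : ℕ) : ℝ)) ≤ 1 := fun n x => by
      have := hT' n
      rw [div_le_one (by positivity)]
      linarith [abs_nonneg x]
    have hlim : ∀ x : ℝ, Tendsto (fun n : ℕ => |x| ^ k * (((n + T : ℕ) : ℝ) /
        (|x| + ((n + T : ℕ) : ℝ)))) atTop (𝓝 (|x| ^ k)) := by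
      intro x
      have h1 : Tendsto (fun n : ℕ => |x| / (|x| + ((n + T : ℕ) : ℝ))) atTop (𝓝 0) := by
        refine Tendsto.div_atTop tendsto_const_nhds (tendsto_atTop_add_const_left _ _ ?_)
        exact tendsto_natCast_atTop_atTop.comp (tendsto_add_atTop_nat T)
      have h2 := ((tendsto_const_nhds (x := (1 : ℝ))).sub h1).const_mul (|x| ^ k)
      rw [sub_zero, mul_one] at h2
      refine h2.congr fun n => ?_
      have := hT' n
      congr 1
      field_simp
      ring
    have hnn : ∀ (n : ℕ) (x : ℝ), 0 ≤ |x| ^ k * (((n + T : ℕ) : ℝ) / (|x| + ((n + T : ℕ) : ℝ))) :=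
      fun n x => by positivity
    -- Fatou's lemma: the weighted integrals have a finite limit.
    have hi : Integrable (fun x : ℝ => |x| ^ k) F := by
      refine integrable_of_tendsto (G := fun (n : ℕ) x => |x| ^ k * (((n + T : ℕ) : ℝ) /
        (|x| + ((n + T : ℕ) : ℝ)))) (.of_forall hlim)
        (fun n => (hk (n + T) (by omega)).1.aestronglyMeasurable) ?_
      have h1 : ∀ n : ℕ, ∫⁻ x, ‖|x| ^ k * (((n + T : ℕ) : ℝ) / (|x| + ((n + T : ℕ) : ℝ)))‖ₑ ∂F =
          ENNReal.ofReal (shiftedSeries c k ((n + T : ℕ) : ℝ)) := by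
        intro n
        obtain ⟨h2, h3⟩ := hk (n + T) (by omega)
        rw [← h3, ofReal_integral_eq_lintegral_ofReal h2 (.of_forall (hnn n))]
        exact lintegral_congr fun x => Real.enorm_of_nonneg (hnn n x)
      simp only [h1]
      rw [(ENNReal.tendsto_ofReal (tendsto_shiftedSeries hR hc hT k)).liminf_eq]
      exact ENNReal.ofReal_ne_top
    refine ⟨hi, ?_⟩
    have h1 := tendsto_integral_of_dominated_convergence (μ := F)
      (F := fun (n : ℕ) (x : ℝ) => |x| ^ k * (((n + T : ℕ) : ℝ) / (|x| + ((n + T : ℕ) : ℝ))))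
      (fun x => |x| ^ k) (fun n => (hk (n + T) (by omega)).1.aestronglyMeasurable) hi
      (fun n => .of_forall fun x => by
        rw [Real.norm_of_nonneg (hnn n x)]
        exact mul_le_of_le_one_right (by positivity) (hle n x)) (.of_forall hlim)
    simp only [fun n : ℕ => (hk (n + T) (by omega)).2] at h1
    exact tendsto_nhds_unique h1 (tendsto_shiftedSeries hR hc hT k)
  refine step k ?_
  induction k with
  | zero =>
    intro t ht
    have ht0 : (0 : ℝ) < t := by exact_mod_cast hT0.trans_le ht
    simp only [pow_zero, one_mul]
    constructor
    · refine integrable_of_measurable_of_abs_le (C := 1) (by fun_prop) fun x => ?_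
      rw [abs_of_nonneg (by positivity), div_le_one (by positivity)]
      linarith [abs_nonneg x]
    · have h1 : ∀ x : ℝ, (t : ℝ) / (|x| + t) = t * (1 / (|x| + t)) := fun x => by ring
      simp only [h1]
      rw [integral_const_mul, h t ht, ← mul_assoc, mul_one_div_cancel ht0.ne', one_mul]
  | succ k ih =>
    obtain ⟨hi, hm⟩ := step k ih
    intro t ht
    have ht0 : (0 : ℝ) < t := by exact_mod_cast hT0.trans_le ht
    have ht2 : 2 * R ≤ t := hT.trans (by exact_mod_cast ht)
    -- From `|x| / (|x| + t) = 1 - t / (|x| + t)`, which mirrors the recursion of `shiftedSeries`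
    -- and passes from `k` to `k + 1`.
    have h1 : ∀ x : ℝ, |x| ^ (k + 1) * (t / (|x| + t)) =
        t * (|x| ^ k - |x| ^ k * (t / (|x| + t))) := fun x => by
      field_simp
      ring
    simp only [h1]
    obtain ⟨h2, h3⟩ := ih t ht
    refine ⟨(hi.sub h2).const_mul _, ?_⟩
    rw [integral_const_mul, integral_sub hi h2, hm, h3, shiftedSeries_eq hR hc ht2 k,
      sub_sub_cancel, ← mul_assoc, mul_one_div_cancel ht0.ne', one_mul]

end Stieltjes

/-! ### Tightness and identification of the weak limit -/

/-- The function `x ↦ 1 / (|x| + t)`. -/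
noncomputable def stieltjesKernel (t : ℝ) (ht : 0 < t) : BoundedContinuousFunction ℝ ℝ :=
  BoundedContinuousFunction.ofNormedAddCommGroup (fun x => 1 / (|x| + t))
    (continuous_const.div (by fun_prop) fun x => by positivity) (1 / t) fun x => by
      rw [Real.norm_of_nonneg (by positivity)]
      exact one_div_le_one_div_of_le ht (by linarith [abs_nonneg x])

/-- The bounded continuous function `x ↦ min (max (-x) 0) 1`. -/
noncomputable def truncatedNegPart : BoundedContinuousFunction ℝ ℝ :=
  BoundedContinuousFunction.ofNormedAddCommGroup (fun x => min (max (-x) 0) 1)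
    (by fun_prop) 1 fun x => by
      rw [Real.norm_of_nonneg (by positivity)]
      exact min_le_right _ _

section Limit

variable {c : ℕ → ℝ} {R : ℝ} {μ : ℕ → ProbabilityMeasure ℝ} {T : ℕ}

/-- Where `|x| > t` the function `1 - t / (|x| + t)` exceeds `1 / 2`, so the mass there is at most
twice its integral. As `N → ∞` this integral tends to `1 - shiftedSeries c 0 t`, which is small for
large `t` because `c 0 = 1`. -/
theorem isTightMeasureSet_of_stieltjes (hR : 0 < R) (hc : ∀ k, |c k| ≤ R ^ k) (hc0 : c 0 = 1)
    (hT : 2 * R ≤ T) (h : ∀ t : ℕ, T ≤ t → Tendsto (fun N => ∫ x, 1 / (|x| + t) ∂(μ N : Measure ℝ))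
      atTop (𝓝 (1 / t * shiftedSeries c 0 t))) :
    IsTightMeasureSet (Set.range fun N => (μ N : Measure ℝ)) := by
  have hT0 : 0 < T := by
    have : (0 : ℝ) < T := by linarith
    exact_mod_cast this
  refine isTightMeasureSet_range_of_tendsto_limsup_measure_norm_gt ?_
  have hmass : ∀ (t : ℕ), T ≤ t → ∀ N, (μ N : Measure ℝ).real {x | (t : ℝ) < ‖x‖} ≤
      2 * (1 - t * ∫ x, 1 / (|x| + t) ∂(μ N : Measure ℝ)) := by
    intro t ht N
    have ht0 : (0 : ℝ) < t := by exact_mod_cast hT0.trans_le ht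
    have hk : Integrable (fun x : ℝ => 1 / (|x| + t)) (μ N : Measure ℝ) :=
      (stieltjesKernel t ht0).integrable _
    have h1 := mul_meas_ge_le_integral_of_nonneg (μ := (μ N : Measure ℝ))
      (f := fun x : ℝ => 1 - t * (1 / (|x| + t))) (.of_forall fun x => by
        have : (t : ℝ) / (|x| + t) ≤ 1 := by
          rw [div_le_one (by positivity)]
          linarith [abs_nonneg x]
        simp only [Pi.zero_apply, mul_one_div]
        linarith) ((integrable_const 1).sub (hk.const_mul _)) (1 / 2)
    rw [integral_sub (integrable_const 1) (hk.const_mul _), integral_const_mul] at h1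
    simp only [integral_const, probReal_univ, one_smul] at h1
    have h2 : {x : ℝ | (t : ℝ) < ‖x‖} ⊆ {x : ℝ | 1 / 2 ≤ 1 - t * (1 / (|x| + t))} := by
      intro x hx
      simp only [Set.mem_ofPred_eq, Real.norm_eq_abs] at hx ⊢
      have : (t : ℝ) / (|x| + t) ≤ 1 / 2 := by
        rw [div_le_div_iff₀ (by positivity) two_pos]
        linarith
      rw [mul_one_div]
      linarith
    have h3 := measureReal_mono (μ := (μ N : Measure ℝ)) h2
    linarith
  have hlim : Tendsto (fun n : ℕ => 2 * (1 - shiftedSeries c 0 ((n + T : ℕ) : ℝ))) atTop (𝓝 0) := by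
    have := ((tendsto_shiftedSeries hR hc hT 0).const_sub 1).const_mul 2
    rwa [hc0, sub_self, mul_zero] at this
  rw [ENNReal.tendsto_nhds_zero]
  intro ε hε
  obtain ⟨δ, hδ0, hδ⟩ : ∃ δ : ℝ, 0 < δ ∧ ENNReal.ofReal δ ≤ ε := by
    obtain ⟨δ, hδ0, hδ⟩ := ENNReal.lt_iff_exists_nnreal_btwn.1 hε
    refine ⟨δ, by exact_mod_cast hδ0, ?_⟩
    rw [ENNReal.ofReal_coe_nnreal]
    exact hδ.le
  obtain ⟨n, hn⟩ := (hlim.eventually_lt_const hδ0).exists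
  set t := n + T with ht
  have ht0 : (0 : ℝ) < t := by
    have : 0 < t := by omega
    exact_mod_cast this
  have hN : ∀ᶠ N in atTop, 2 * (1 - t * ∫ x, 1 / (|x| + t) ∂(μ N : Measure ℝ)) < δ := by
    have h1 := (((h t (by omega)).const_mul (t : ℝ)).const_sub 1).const_mul 2
    rw [← mul_assoc, mul_one_div_cancel ht0.ne', one_mul] at h1
    exact h1.eventually_lt_const hn
  filter_upwards [eventually_ge_atTop (t : ℝ)] with r hr
  refine (limsup_le_of_le ⟨0, by simp⟩ ?_).trans hδ
  filter_upwards [hN] with N hN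
  have h1 : {x : ℝ | r < ‖x‖} ⊆ {x : ℝ | (t : ℝ) < ‖x‖} := fun x hx => lt_of_le_of_lt hr hx
  refine (measure_mono h1).trans ?_
  rw [← ofReal_measureReal]
  exact ENNReal.ofReal_le_ofReal ((hmass t (by omega) N).trans hN.le)

/-- A sequence of probability measures on `[0, ∞)` whose Stieltjes transforms converge to the
transform given by a moment sequence of at most exponential growth converges weakly to a compactly
supported measure with these moments. -/
theorem exists_tendsto_of_stieltjes (hR : 0 < R) (hc : ∀ k, |c k| ≤ R ^ k) (hc0 : c 0 = 1)
    (hT : 2 * R ≤ T) (hμ : ∀ N, ∀ᵐ x ∂(μ N : Measure ℝ), 0 ≤ x)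
    (h : ∀ t : ℕ, T ≤ t → Tendsto (fun N => ∫ x, 1 / (|x| + t) ∂(μ N : Measure ℝ))
      atTop (𝓝 (1 / t * shiftedSeries c 0 t))) :
    ∃ F : ProbabilityMeasure ℝ, (F : Measure ℝ) (Set.Icc 0 R)ᶜ = 0 ∧
      (∀ k : ℕ, Integrable (fun s : ℝ => s ^ k) (F : Measure ℝ) ∧
        ∫ s, s ^ k ∂(F : Measure ℝ) = c k) ∧ Tendsto μ atTop (𝓝 F) := by
  have hT0 : 0 < T := by
    have : (0 : ℝ) < T := by linarith
    exact_mod_cast this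
  have hcluster : ∀ F : ProbabilityMeasure ℝ, MapClusterPt F atTop μ →
      (∀ᵐ x ∂(F : Measure ℝ), 0 ≤ x) ∧ (∀ k : ℕ, Integrable (fun s : ℝ => s ^ k) (F : Measure ℝ) ∧
        ∫ s, s ^ k ∂(F : Measure ℝ) = c k) := by
    intro F hF
    obtain ⟨U, hU, hlim⟩ := mapClusterPt_iff_ultrafilter.1 hF
    rw [ProbabilityMeasure.tendsto_iff_forall_integral_tendsto] at hlim
    -- Nonnegativity passes to the limit through a bounded continuous test function vanishing
    -- exactly on `[0, ∞)`.
    have hpos : ∀ᵐ x ∂(F : Measure ℝ), 0 ≤ x := by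
      have h1 := hlim truncatedNegPart
      have h2 : ∀ N, ∫ x, truncatedNegPart x ∂(μ N : Measure ℝ) = 0 := by
        intro N
        refine integral_eq_zero_of_ae ?_
        filter_upwards [hμ N] with x hx
        change min (max (-x) 0) 1 = 0
        rw [max_eq_right (by linarith)]
        simp
      simp only [h2] at h1
      have h3 := tendsto_nhds_unique h1 tendsto_const_nhds
      have h4 := (integral_eq_zero_iff_of_nonneg (μ := (F : Measure ℝ))
        (f := fun x => truncatedNegPart x) (fun x => by
          change 0 ≤ min (max (-x) 0) 1
          positivity) (truncatedNegPart.integrable _)).1 h3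
      filter_upwards [h4] with x hx
      change min (max (-x) 0) 1 = 0 at hx
      by_contra! hneg
      have : 0 < min (max (-x) 0) 1 := lt_min (lt_max_of_lt_left (by linarith)) one_pos
      linarith
    have hst : ∀ t : ℕ, T ≤ t →
        ∫ x, 1 / (|x| + t) ∂(F : Measure ℝ) = 1 / t * shiftedSeries c 0 t := by
      intro t ht
      have ht0 : (0 : ℝ) < t := by exact_mod_cast hT0.trans_le ht
      exact tendsto_nhds_unique (hlim (stieltjesKernel t ht0)) ((h t ht).mono_left hU)
    refine ⟨hpos, fun k => ?_⟩
    obtain ⟨h1, h2⟩ := moments_of_stieltjes hR hc hT hst k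
    have h3 : (fun s : ℝ => |s| ^ k) =ᵐ[(F : Measure ℝ)] fun s => s ^ k := by
      filter_upwards [hpos] with x hx
      rw [abs_of_nonneg hx]
    exact ⟨h1.congr h3, (integral_congr_ae h3).symm.trans h2⟩
  have hcR : ∀ k, c k ≤ R ^ k := fun k => (le_abs_self _).trans (hc k)
  have hcompact : IsCompact (closure (Set.range μ)) := by
    refine isCompact_closure_of_isTightMeasureSet ?_
    convert isTightMeasureSet_of_stieltjes hR hc hc0 hT h using 1
    ext ν
    simp
  have hmem : ∀ N, μ N ∈ closure (Set.range μ) := fun N => subset_closure ⟨N, rfl⟩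
  obtain ⟨F, -, hF⟩ := hcompact.exists_mapClusterPt (f := atTop) (u := μ)
    (tendsto_principal.2 (.of_forall hmem))
  obtain ⟨hpos, hmom⟩ := hcluster F hF
  refine ⟨F, ?_, hmom, ?_⟩
  · have h1 := ae_abs_le_of_moments_le hR (fun k => (hmom k).1) fun k => (hmom k).2.trans_le (hcR k)
    have h2 : ∀ᵐ x ∂(F : Measure ℝ), x ∈ Set.Icc 0 R := by
      filter_upwards [hpos, h1] with x hx hx'
      exact ⟨hx, (le_abs_self x).trans hx'⟩
    exact h2
  -- All cluster points have the moments `c`, hence coincide, and compactness upgrades this to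
  -- convergence.
  · refine hcompact.tendsto_nhds_of_unique_mapClusterPt (.of_forall hmem) fun G _ hG => ?_
    have h1 : (G : Measure ℝ) = F := eq_of_moments_eq hR hcR (hcluster G hG).2 hmom
    exact Subtype.ext h1

end Limit

/-! ### Spectral distributions and their Stieltjes transforms -/

namespace Matrix

variable {n : Type*} [Fintype n] [DecidableEq n] {A : Matrix n n ℂ} {W : Matrix n n ℂ}

open scoped ComplexOrder in
theorem eigenvalues_nonneg_of_eq (hW : W.IsHermitian) (hA : W = Aᴴ * A) (j : n) :
    0 ≤ hW.eigenvalues j := by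
  subst hA
  exact (posSemidef_conjTranspose_mul_self A).eigenvalues_nonneg j

/-- Both sides are the trace of the resolvent, the left one computed after diagonalizing `W`. -/
theorem sum_one_div_eigenvalues_add {t : ℝ} (ht : 0 < t) (hW : W.IsHermitian) (hA : W = Aᴴ * A) :
    ∑ j, 1 / (hW.eigenvalues j + t) = ∑ j, (A.colResolvent t j j).re := by
  set U := hW.eigenvectorUnitary
  set D : Matrix n n ℂ := diagonal fun j => ((hW.eigenvalues j : ℝ) : ℂ)
  set E : Matrix n n ℂ := diagonal fun j => ((1 / (hW.eigenvalues j + t) : ℝ) : ℂ)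
  have hU : (star (U : Matrix n n ℂ)) * U = 1 := Unitary.coe_star_mul_self U
  have hU' : (U : Matrix n n ℂ) * star (U : Matrix n n ℂ) = 1 := Unitary.coe_mul_star_self U
  have hspec : W = U * D * star (U : Matrix n n ℂ) := by
    have := hW.spectral_theorem
    rwa [Unitary.conjStarAlgAut_apply] at this
  have hDE : (D + (t : ℂ) • 1) * E = 1 := by
    rw [← diagonal_one, ← diagonal_smul, diagonal_add, diagonal_mul_diagonal]
    congr 1
    ext j
    have h := eigenvalues_nonneg_of_eq hW hA j
    have h' : ((hW.eigenvalues j : ℂ) + t) ≠ 0 := by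
      rw [← Complex.ofReal_add]
      exact_mod_cast (by positivity : hW.eigenvalues j + t ≠ 0)
    simp [h']
  have hres : A.colResolvent t = U * E * star (U : Matrix n n ℂ) := by
    refine inv_eq_right_inv ?_
    have h1 : Aᴴ * A + (t : ℂ) • (1 : Matrix n n ℂ) =
        U * (D + (t : ℂ) • 1) * star (U : Matrix n n ℂ) := by
      rw [mul_add, add_mul, ← hspec, ← hA, mul_smul_comm, smul_mul_assoc, mul_one, hU']
    rw [h1]
    calc _ = (U : Matrix n n ℂ) * (D + (t : ℂ) • 1) * (star (U : Matrix n n ℂ) * U) * E *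
        star (U : Matrix n n ℂ) := by simp only [mul_assoc]
      _ = U * ((D + (t : ℂ) • 1) * E) * star (U : Matrix n n ℂ) := by
        rw [hU, mul_one]; simp only [mul_assoc]
      _ = 1 := by rw [hDE, mul_one, hU']
  have htr : (A.colResolvent t).trace = E.trace := by
    rw [hres, mul_assoc, trace_mul_comm, mul_assoc, hU, mul_one]
  have := congrArg Complex.re htr
  simp only [trace, diag_apply, Complex.re_sum, E, diagonal_apply_eq, Complex.ofReal_re] at this
  exact this.symm

end Matrix

section Empirical

variable {n : ℕ}

/-- The uniform probability measure on a nonempty finite family of reals. -/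
noncomputable def empiricalMeasure (hn : 0 < n) (v : Fin n → ℝ) : ProbabilityMeasure ℝ :=
  ⟨(n : ENNReal)⁻¹ • ∑ j, Measure.dirac (v j), ⟨by
    simp [ENNReal.inv_mul_cancel (Nat.cast_ne_zero.2 hn.ne') (ENNReal.natCast_ne_top n)]⟩⟩

variable (hn : 0 < n) (v : Fin n → ℝ)

theorem coe_empiricalMeasure : (empiricalMeasure hn v : Measure ℝ) =
    (n : ENNReal)⁻¹ • ∑ j, Measure.dirac (v j) := rfl

theorem integral_empiricalMeasure (f : ℝ → ℝ) :
    ∫ x, f x ∂(empiricalMeasure hn v : Measure ℝ) = (n : ℝ)⁻¹ * ∑ j, f (v j) := by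
  rw [coe_empiricalMeasure, integral_smul_measure,
    integral_finsetSum_measure fun j _ => integrable_dirac (by simp)]
  simp

theorem empiricalMeasure_real_Iic (s : ℝ) :
    (empiricalMeasure hn v : Measure ℝ).real (Set.Iic s) = Nat.card {j // v j ≤ s} / n := by
  rw [coe_empiricalMeasure, measureReal_def]
  simp only [Measure.smul_apply, Measure.finsetSum_apply, smul_eq_mul, ENNReal.toReal_mul,
    ENNReal.toReal_inv, ENNReal.toReal_natCast, Measure.dirac_apply' _ measurableSet_Iic]
  rw [ENNReal.toReal_sum fun j _ => by by_cases h : v j ≤ s <;> simp [h]]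
  rw [Nat.card_eq_fintype_card, Fintype.card_subtype, Finset.card_filter, inv_mul_eq_div]
  push_cast
  congr 1
  refine Finset.sum_congr rfl fun j _ => ?_
  by_cases h : v j ≤ s <;> simp [h]

theorem ae_empiricalMeasure {p : ℝ → Prop} (hp : MeasurableSet {x | p x}) (h : ∀ j, p (v j)) :
    ∀ᵐ x ∂(empiricalMeasure hn v : Measure ℝ), p x := by
  rw [ae_iff, coe_empiricalMeasure]
  have : MeasurableSet {x | ¬ p x} := hp.compl
  simp [Measure.dirac_apply' _ this, h]

end Empirical

/-- Continuity of the distribution function at `s` means that `s`, the frontier of the half-line,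
carries no mass, so the portmanteau theorem applies. -/
theorem tendsto_measure_Iic_of_continuousAt_cdf {μ : ℕ → ProbabilityMeasure ℝ}
    {F : ProbabilityMeasure ℝ} (h : Tendsto μ atTop (𝓝 F)) {s : ℝ}
    (hs : ContinuousAt (cdf (F : Measure ℝ)) s) :
    Tendsto (fun N => (μ N : Measure ℝ).real (Set.Iic s)) atTop (𝓝 (cdf (F : Measure ℝ) s)) := by
  have h0 : (F : Measure ℝ) (frontier (Set.Iic s)) = 0 := by
    rw [frontier_Iic, ← measure_cdf (F : Measure ℝ), StieltjesFunction.measure_singleton,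
      leftLim_eq_of_tendsto (hs.tendsto.mono_left nhdsWithin_le_nhds), sub_self, ENNReal.ofReal_zero]
  have h1 := ProbabilityMeasure.tendsto_measure_of_null_frontier_of_tendsto' h h0
  rw [cdf_eq_real]
  exact (ENNReal.tendsto_toReal (measure_ne_top _ _)).comp h1

section Spectrum

open YoungDiagram

variable {lam : YoungDiagram}

theorem YoungDiagram.length_pos (hne : lam ≠ ⊥) : 0 < lam.length := by
  by_contra! h
  refine hne (YoungDiagram.ext (Finset.eq_empty_of_forall_notMem ?_))
  rintro ⟨i, j⟩ hc
  have h0 := mem_iff_lt_colLen.1 (lam.up_left_mem (Nat.zero_le i) (Nat.zero_le j) hc)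
  unfold length at h
  omega

theorem covMatrix_eq (x : ℕ → ℕ → ℂ) (N : ℕ) : covMatrix lam x N =
    (scaledMatrix lam N fun i j => x i j) *
      (scaledMatrix lam N fun i j => x i j).conjTranspose := by
  have h : (scaledMatrix lam N fun i j => x i j) = ((√N)⁻¹ : ℝ) • shapedMatrix lam x N := by
    ext i j
    simp only [scaledMatrix, shapedMatrix, Matrix.of_apply, Matrix.smul_apply]
    split_ifs <;> simp
  rw [h, covMatrix, Matrix.conjTranspose_smul, star_trivial, smul_mul_assoc, mul_smul_comm,
    smul_smul, ← mul_inv, Real.mul_self_sqrt (Nat.cast_nonneg N)]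

theorem sum_block (N : ℕ) (f : Fin (N * lam.length) → ℝ) :
    ∑ b : Fin lam.length, ∑ j ∈ block b, f j = ∑ j, f j :=
  Finset.sum_fiberwise _ _ _

/-- The spectral distribution of the covariance matrix. -/
noncomputable def spectralMeasure (hl : 0 < lam.length) (x : ℕ → ℕ → ℂ) (N : ℕ) :
    ProbabilityMeasure ℝ :=
  empiricalMeasure (Nat.mul_pos N.succ_pos hl) (covMatrix_isHermitian lam x (N + 1)).eigenvalues

variable (hl : 0 < lam.length) (x : ℕ → ℕ → ℂ) (N : ℕ)

theorem spectralMeasure_real_Iic (s : ℝ) :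
    (spectralMeasure hl x N : Measure ℝ).real (Set.Iic s) = empiricalCDF lam x (N + 1) s := by
  rw [spectralMeasure, empiricalMeasure_real_Iic, empiricalCDF]
  push_cast
  rfl

theorem covMatrix_eq_conjTranspose_mul : covMatrix lam x N =
    ((scaledMatrix lam N fun i j => x i j).conjTranspose).conjTranspose *
      (scaledMatrix lam N fun i j => x i j).conjTranspose := by
  rw [Matrix.conjTranspose_conjTranspose, covMatrix_eq]

theorem ae_nonneg_spectralMeasure : ∀ᵐ y ∂(spectralMeasure hl x N : Measure ℝ), 0 ≤ y :=
  ae_empiricalMeasure _ _ measurableSet_Ici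
    (Matrix.eigenvalues_nonneg_of_eq _ (covMatrix_eq_conjTranspose_mul x (N + 1)))

theorem integral_spectralMeasure {t : ℝ} (ht : 0 < t) :
    ∫ y, 1 / (|y| + t) ∂(spectralMeasure hl x N : Measure ℝ) = (lam.length : ℝ)⁻¹ *
      ∑ b, blockTrace t (scaledMatrix lam (N + 1) fun i j => x i j).conjTranspose b := by
  rw [spectralMeasure, integral_empiricalMeasure]
  have h := covMatrix_eq_conjTranspose_mul (lam := lam) x (N + 1)
  simp only [fun j => abs_of_nonneg (Matrix.eigenvalues_nonneg_of_eq
    (covMatrix_isHermitian lam x (N + 1)) h j)]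
  rw [Matrix.sum_one_div_eigenvalues_add ht _ h]
  simp only [blockTrace]
  rw [← Finset.mul_sum, sum_block]
  push_cast
  rw [mul_inv]
  ring

end Spectrum

/-! ### The limiting spectral distribution -/

section SpectralLimit

open YoungDiagram

variable {lam : YoungDiagram}

theorem sum_treeTransform (hl : 0 < lam.length) (hconj : lam.transpose = lam) {t : ℝ}
    (ht : 8 * (lam.length : ℝ) ≤ t) :
    (lam.length : ℝ)⁻¹ * ∑ b : Fin lam.length, treeTransform t b =
      1 / t * shiftedSeries (fun k => (lambdaCatalan lam k : ℝ) / lam.length) 0 t := by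
  have hl' : (0 : ℝ) < lam.length := by exact_mod_cast hl
  have ht0 : 0 < t := by linarith
  simp only [treeTransform, shiftedSeries, zero_add]
  rw [← Finset.mul_sum, ← Summable.tsum_finsetSum fun b _ =>
    (summable_card_rootedTrees hconj ht ht0 b).of_norm, mul_left_comm, ← tsum_mul_left]
  congr 1
  refine tsum_congr fun k => ?_
  rw [lambdaCatalan_eq_sum, ← Finset.sum_mul]
  push_cast
  ring

theorem abs_lambdaCatalan_div_le (hl : 0 < lam.length) (hconj : lam.transpose = lam) (k : ℕ) :
    |(lambdaCatalan lam k : ℝ) / lam.length| ≤ (4 * lam.length : ℝ) ^ k := by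
  have hl' : (0 : ℝ) < lam.length := by exact_mod_cast hl
  rw [abs_of_nonneg (by positivity), div_le_iff₀' hl']
  exact lambdaCatalan_le hconj k

variable {Ω : Type*} [MeasurableSpace Ω] {P : Measure Ω} [IsProbabilityMeasure P]
  {X : ℕ → ℕ → Ω → ℂ}

/-- Almost sure weak convergence of the spectral distributions. -/
theorem IsStandardArray.ae_exists_tendsto_spectralMeasure (hX : IsStandardArray P X)
    (hl : 0 < lam.length) (hconj : lam.transpose = lam) :
    ∀ᵐ ω ∂P, ∃ F : ProbabilityMeasure ℝ, (F : Measure ℝ) (Set.Icc 0 (4 * lam.length : ℝ))ᶜ = 0 ∧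
      HasLambdaMoments lam F ∧
      Tendsto (spectralMeasure hl fun i j => X i j ω) atTop (𝓝 F) := by
  have hl' : (0 : ℝ) < lam.length := by exact_mod_cast hl
  -- Since `W = A Aᴴ`, its Stieltjes transform involves the block traces of `Aᴴ`, which is the
  -- scaled matrix of the conjugate transposed array.
  filter_upwards [hX.conjTranspose.ae_tendsto_blockTrace hconj] with ω hω
  refine exists_tendsto_of_stieltjes (T := 8 * lam.length) (by positivity)
    (abs_lambdaCatalan_div_le hl hconj) ?_ ?_ (ae_nonneg_spectralMeasure hl _) fun t ht => ?_
  · rw [lambdaCatalan_zero, div_self hl'.ne']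
  · push_cast
    linarith
  · have ht0 : 0 < t := by omega
    rw [← sum_treeTransform hl hconj (by exact_mod_cast ht)]
    have h := (tendsto_add_atTop_iff_nat 1).2
      ((tendsto_finsetSum Finset.univ fun b _ => hω t ht ht0 b).const_mul (lam.length : ℝ)⁻¹)
    refine h.congr fun N => ?_
    rw [integral_spectralMeasure hl _ N (by exact_mod_cast ht0),
      ← scaledMatrix_conj_swap hconj (N + 1) N.succ_pos fun i j => X i j ω]

theorem HasLambdaMoments.eq (hl : 0 < lam.length) (hconj : lam.transpose = lam)
    {F G : ProbabilityMeasure ℝ} (hF : HasLambdaMoments lam F) (hG : HasLambdaMoments lam G) :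
    F = G := by
  have hl' : (0 : ℝ) < lam.length := by exact_mod_cast hl
  exact Subtype.ext (eq_of_moments_eq (F := (F : Measure ℝ)) (G := (G : Measure ℝ))
    (R := 4 * lam.length) (by positivity)
    (fun k => (le_abs_self _).trans (abs_lambdaCatalan_div_le hl hconj k)) hF hG)

end SpectralLimit

/-! ### A concrete array, and the theorem -/

/-- The uniform distribution on `{1, -1}`. -/
noncomputable def rademacher : Measure ℂ :=
  (2 : ENNReal)⁻¹ • (Measure.dirac 1 + Measure.dirac (-1))

instance : IsProbabilityMeasure rademacher :=
  ⟨by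
    simp only [rademacher, Measure.smul_apply, Measure.add_apply, measure_univ, smul_eq_mul]
    rw [one_add_one_eq_two, ENNReal.inv_mul_cancel two_ne_zero ENNReal.ofNat_ne_top]⟩

theorem integral_rademacher {E : Type*} [NormedAddCommGroup E] [NormedSpace ℝ E] [CompleteSpace E]
    (f : ℂ → E) : ∫ z, f z ∂rademacher = (2 : ℝ)⁻¹ • (f 1 + f (-1)) := by
  rw [rademacher, integral_smul_measure, integral_add_measure (integrable_dirac (by simp))
    (integrable_dirac (by simp))]
  simp

/-- At least one standard array is needed to produce `F` before any probability space is given. -/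
theorem isStandardArray_rademacher :
    IsStandardArray (Measure.infinitePi fun _ : ℕ × ℕ => rademacher) fun i j ω => ω (i, j) := by
  have hmap : ∀ p : ℕ × ℕ, (Measure.infinitePi fun _ : ℕ × ℕ => rademacher).map
      (fun ω => ω p) = rademacher := fun p => Measure.infinitePi_map_eval _ p
  have hm : ∀ p : ℕ × ℕ, Measurable fun ω : ℕ × ℕ → ℂ => ω p := measurable_pi_apply
  refine ⟨fun i j => hm _, ?_, fun i j => ⟨(hm _).aemeasurable, (hm _).aemeasurable, ?_⟩, ?_, ?_, ?_⟩
  · exact iIndepFun_infinitePi (X := fun _ z => z) fun _ => measurable_id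
  · rw [hmap, hmap]
  · have h : MemLp (id : ℂ → ℂ) 2 rademacher := by
      refine MemLp.of_bound (by fun_prop) 1 ?_
      rw [ae_iff]
      simp [rademacher]
    rw [← hmap (0, 0)] at h
    exact (memLp_map_measure_iff (by fun_prop) (hm (0, 0)).aemeasurable).1 h
  · have h := integral_map (μ := Measure.infinitePi fun _ : ℕ × ℕ => rademacher)
      (hm (0, 0)).aemeasurable (f := fun z : ℂ => z) (by fun_prop)
    rw [hmap, integral_rademacher] at h
    rw [← h]
    simp
  · have h := integral_map (μ := Measure.infinitePi fun _ : ℕ × ℕ => rademacher)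
      (hm (0, 0)).aemeasurable (f := fun z : ℂ => ‖z‖ ^ 2) (by fun_prop)
    rw [hmap, integral_rademacher] at h
    rw [← h]
    norm_num

theorem theorem3p1 (lam : YoungDiagram) (hne : lam ≠ ⊥) (hconj : lam.transpose = lam) :
    ∃ F : ProbabilityMeasure ℝ,
      (∃ R : ℝ, (F : Measure ℝ) (Set.Icc 0 R)ᶜ = 0) ∧
      HasLambdaMoments lam F ∧
      (∀ G : ProbabilityMeasure ℝ, HasLambdaMoments lam G → G = F) ∧
      ∀ (Ω : Type*) [MeasurableSpace Ω] (P : Measure Ω) [IsProbabilityMeasure P]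
        (X : ℕ → ℕ → Ω → ℂ),
        (∀ i j, Measurable (X i j)) →
        iIndepFun (fun p : ℕ × ℕ => X p.1 p.2) P →
        (∀ i j, IdentDistrib (X i j) (X 0 0) P P) →
        MemLp (X 0 0) 2 P →
        ∫ ω, X 0 0 ω ∂P = 0 →
        ∫ ω, ‖X 0 0 ω‖ ^ 2 ∂P = 1 →
        ∀ᵐ ω ∂P, ∀ s : ℝ, ContinuousAt (cdf (F : Measure ℝ)) s →
          Tendsto (fun N : ℕ => empiricalCDF lam (fun i j => X i j ω) N s) atTop
            (𝓝 (cdf (F : Measure ℝ) s)) := by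
  have hl := YoungDiagram.length_pos hne
  -- An almost sure event is nonempty, so one outcome provides a limit with the required moments.
  -- For any other array the limit has the same moments and therefore equals `F`.
  obtain ⟨_, F, hsupp, hF, -⟩ :=
    (isStandardArray_rademacher.ae_exists_tendsto_spectralMeasure hl hconj).exists
  refine ⟨F, ⟨_, hsupp⟩, hF, fun G hG => hG.eq hl hconj hF, ?_⟩
  intro Ω _ P _ X h1 h2 h3 h4 h5 h6
  have hX : IsStandardArray P X := ⟨h1, h2, h3, h4, h5, h6⟩
  filter_upwards [hX.ae_exists_tendsto_spectralMeasure hl hconj] with ω ⟨G, _, hG, hlim⟩ s hs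
  rw [hG.eq hl hconj hF] at hlim
  have h := tendsto_measure_Iic_of_continuousAt_cdf hlim hs
  simp only [spectralMeasure_real_Iic] at h
  -- The spectral measures are indexed by `N + 1`, because the empty matrix at `N = 0` has no
  -- spectral probability measure.
  exact (tendsto_add_atTop_iff_nat 1).1 h
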